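/- We work in many-sorted continuous logic. A signature consists of sorts with bounded diameter, and of function and predicate symbols of finite arity, each with a concave modulus of uniform continuity, each predicate symbol taking values in a prescribed compact interval. A structure has a nonempty complete metric space for every sort, and respects these bounds and moduli. Affine formulas are built from atomic formulas (predicates and distances applied to terms) and real constants by addition, multiplication by real scalars, and the quantifiers $\sup$ and $\inf$. An affine theory is a set of conditions $\varphi\ge 0$, with $\varphi$ an affine sentence; it is complete if it has a model and every affine sentence takes the same value in all of its models. An affine extension $N\succeq^{\mathrm{aff}}M$ is a structure $N$ containing $M$ such that $\varphi^N(m)=\varphi^M(m)$ for every affine formula $\varphi(x)$ and every tuple $m$ in $M$; then $M$ is also called an affine substructure of $N$. For possibly infinite tuples $a,b$ of the same sorts and a set $A$, we write $a\equiv^{\mathrm{aff}}_A b$ if every affine formula with parameters in $A$ takes the same value at $a$ and at $b$. For $A\subseteq M$ and tuples $a,b$ in $M$, say that the Lascar distance (relative to models) of $a$ and $b$ over $A$ is at most $n$ if in some affine extension $N\succeq^{\mathrm{aff}}M$ there are tuples $a=c_0,c_1,\dots,c_n=b$ such that for every $k<n$ there is an affine substructure $K_k$ of $N$ with $A\subseteq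 K_k$ and $c_k\equiv^{\mathrm{aff}}_{K_k}c_{k+1}$. Say that $a$ and $b$ have the same Lascar type over $A$ if this holds for some $n$. **Theorem.** Let $T$ be a complete affine theory, $M\models T$, $A\subseteq M$, and let $a,b$ be (possibly infinite) tuples in $M$, of the same sorts, such that $a\equiv^{\mathrm{aff}}_A b$. Then: 1. For every $B$ with $A\subseteq B\subseteq M$ there exist an affine extension $N\succeq^{\mathrm{aff}}M$ and a subset $B'\subseteq N$ such that $B'\equiv^{\mathrm{aff}}_A B$ (relative to some common enumeration of $B$ and $B'$) and $a\equiv^{\mathrm{aff}}_{B'}b$. In particular $A\subseteq B'$. 2. The Lascar distance of $a$ and $b$ over $A$ is at most one. In particular $a$ and $b$ have the same Lascar type over $A$; that is, every affine type over an arbitrary set is Lascar strong. -/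

import Mathlib

open scoped NNReal

universe u v w

namespace AffineLogic

/-- An `n`-ary modulus of uniform continuity.  As is customary in affine logic it is concave (so that
`L¹`-combinations of structures are again structures); Lipschitz bounds are the case
`Δ r = C * ∑ i, r i`.  Every uniformly continuous function on a bounded metric space admits such a
modulus. -/
structure Modulus (n : ℕ) where
  toFun : (Fin n → ℝ≥0) → ℝ≥0
  map_zero : toFun 0 = 0
  monotone : Monotone toFun
  continuous : Continuous toFun
  concave : ConcaveOn ℝ≥0 Set.univ toFun

instance (n : ℕ) : CoeFun (Modulus n) (fun _ => (Fin n → ℝ≥0) → ℝ≥0) := ⟨Modulus.toFun⟩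

/-- A (many-sorted) signature of continuous logic.  Every sort has a bound on its diameter, every
function and predicate symbol has an arity, sorts for its arguments and a modulus of uniform
continuity, and every predicate symbol takes its values in a prescribed compact interval. -/
structure Signature where
  Sorts : Type u
  diam : Sorts → ℝ≥0
  Func : Type u
  funcArity : Func → ℕ
  funcDom : ∀ f, Fin (funcArity f) → Sorts
  funcCod : Func → Sorts
  funcModulus : ∀ f, Modulus (funcArity f)
  Pred : Type u
  predArity : Pred → ℕ
  predDom : ∀ P, Fin (predArity P) → Sorts
  predLower : Pred → ℝ
  predUpper : Pred → ℝ
  predModulus : ∀ P, Modulus (predArity P)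

/-- A metric structure: every sort is a nonempty complete metric space. -/
structure Structure (L : Signature.{u}) where
  carrier : L.Sorts → Type w
  metric : ∀ s, MetricSpace (carrier s)
  complete : ∀ s, CompleteSpace (carrier s)
  nonempty : ∀ s, Nonempty (carrier s)
  nndist_le : ∀ s (x y : carrier s), nndist x y ≤ L.diam s
  func : ∀ f, (∀ k, carrier (L.funcDom f k)) → carrier (L.funcCod f)
  func_modulus : ∀ f (x y : ∀ k, carrier (L.funcDom f k)),
    nndist (func f x) (func f y) ≤ L.funcModulus f (fun k => nndist (x k) (y k))
  pred : ∀ P, (∀ k, carrier (L.predDom P k)) → ℝ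
  pred_mem : ∀ P x, pred P x ∈ Set.Icc (L.predLower P) (L.predUpper P)
  pred_modulus : ∀ P (x y : ∀ k, carrier (L.predDom P k)),
    nndist (pred P x) (pred P y) ≤ L.predModulus P (fun k => nndist (x k) (y k))

instance (L : Signature.{u}) : CoeFun (Structure.{u, w} L) (fun _ => L.Sorts → Type w) :=
  ⟨Structure.carrier⟩

instance {L : Signature.{u}} (M : Structure.{u, w} L) (s : L.Sorts) : MetricSpace (M s) :=
  M.metric s

/-- Terms of a given sort, with free variables `i : V` of sort `σ i`, and with (de Bruijn) bound
variables whose sorts are listed in `Γ`. -/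
inductive Term (L : Signature.{u}) {V : Type v} (σ : V → L.Sorts) (Γ : List L.Sorts) :
    L.Sorts → Type (max u v)
  | free (i : V) : Term L σ Γ (σ i)
  | bound (j : Fin Γ.length) : Term L σ Γ (Γ.get j)
  | app (f : L.Func) (t : ∀ k, Term L σ Γ (L.funcDom f k)) : Term L σ Γ (L.funcCod f)

/-- Affine formulas: built from atomic formulas (predicate symbols and distances) and real constants
using addition, multiplication by real scalars, and the quantifiers `sup` and `inf`. -/
inductive Formula (L : Signature.{u}) {V : Type v} (σ : V → L.Sorts) :
    List L.Sorts → Type (max u v)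
  | pred {Γ : List L.Sorts} (P : L.Pred) (t : ∀ k, Term L σ Γ (L.predDom P k)) : Formula L σ Γ
  | dist {Γ : List L.Sorts} {s : L.Sorts} (t₁ t₂ : Term L σ Γ s) : Formula L σ Γ
  | const {Γ : List L.Sorts} (r : ℝ) : Formula L σ Γ
  | add {Γ : List L.Sorts} (φ ψ : Formula L σ Γ) : Formula L σ Γ
  | smul {Γ : List L.Sorts} (r : ℝ) (φ : Formula L σ Γ) : Formula L σ Γ
  | sup {Γ : List L.Sorts} (s : L.Sorts) (φ : Formula L σ (s :: Γ)) : Formula L σ Γ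
  | inf {Γ : List L.Sorts} (s : L.Sorts) (φ : Formula L σ (s :: Γ)) : Formula L σ Γ

section Semantics

variable {L : Signature.{u}} {V : Type v} {σ : V → L.Sorts}

/-- The interpretation of a term, given the values `x` of the free and `y` of the bound variables. -/
def Term.eval (M : Structure.{u, w} L) (x : ∀ i, M (σ i)) {Γ : List L.Sorts}
    (y : ∀ j : Fin Γ.length, M (Γ.get j)) : {s : L.Sorts} → Term L σ Γ s → M s
  | _, .free i => x i
  | _, .bound j => y j
  | _, .app f t => M.func f (fun k => (t k).eval M x y)

/-- The extension of an assignment of the bound variables by one new value. -/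
def extend (M : Structure.{u, w} L) {Γ : List L.Sorts} {s : L.Sorts} (z : M s)
    (y : ∀ j : Fin Γ.length, M (Γ.get j)) : ∀ j : Fin (s :: Γ).length, M ((s :: Γ).get j) :=
  Fin.cons (α := fun j : Fin (Γ.length + 1) => M ((s :: Γ).get j)) z y

/-- The interpretation of an affine formula. -/
noncomputable def Formula.eval (M : Structure.{u, w} L) (x : ∀ i, M (σ i)) :
    {Γ : List L.Sorts} → Formula L σ Γ → (∀ j : Fin Γ.length, M (Γ.get j)) → ℝ
  | _, .pred P t, y => M.pred P (fun k => (t k).eval M x y)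
  | _, .dist t₁ t₂, y => Dist.dist (t₁.eval M x y) (t₂.eval M x y)
  | _, .const r, _ => r
  | _, .add φ ψ, y => φ.eval M x y + ψ.eval M x y
  | _, .smul r φ, y => r * φ.eval M x y
  | _, .sup s φ, y => ⨆ z : M s, φ.eval M x (extend M z y)
  | _, .inf s φ, y => ⨅ z : M s, φ.eval M x (extend M z y)

/-- The value `φ(x)` in `M` of an affine formula `φ` without unquantified bound variables. -/
noncomputable def Formula.value (M : Structure.{u, w} L) (φ : Formula L σ [])
    (x : ∀ i, M (σ i)) : ℝ :=
  φ.eval M x (fun j => j.elim0)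

end Semantics

section Theories

/-- Affine sentences: affine formulas without free variables. -/
abbrev Sentence (L : Signature.{u}) : Type u :=
  Formula L (V := PEmpty.{u + 1}) (fun i => i.elim) []

/-- The value of an affine sentence in a structure. -/
noncomputable def Structure.sentenceValue {L : Signature.{u}} (M : Structure.{u, w} L)
    (φ : Sentence L) : ℝ :=
  φ.value M (fun i => i.elim)

/-- An affine theory: a set of affine sentences `φ`, read as the set of conditions `0 ≤ φ`. -/
abbrev Theory (L : Signature.{u}) : Type u := Set (Sentence L)

/-- `M ⊨ T`. -/
def Structure.Models {L : Signature.{u}} (M : Structure.{u, w} L) (T : Theory L) : Prop :=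
  ∀ φ ∈ T, 0 ≤ M.sentenceValue φ

/-- A complete affine theory: it has a model, and all its models assign the same value to every affine
sentence.  By the downward Löwenheim-Skolem theorem it suffices to consider models in the universe
of the signature. -/
def Theory.IsComplete {L : Signature.{u}} (T : Theory L) : Prop :=
  (∃ M : Structure.{u, u} L, M.Models T) ∧
    ∀ M N : Structure.{u, u} L, M.Models T → N.Models T →
      ∀ φ : Sentence L, M.sentenceValue φ = N.sentenceValue φ

end Theories

section Types

variable {L : Signature.{u}}

/-- An affine embedding: a map that preserves the values of all affine formulas.  Through it the target
is an affine extension of the source, and the source is (up to isomorphism) an affine substructure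
of the target. -/
structure AffineEmbedding (M : Structure.{u, v} L) (N : Structure.{u, w} L) where
  toFun : ∀ s, M s → N s
  value_eq : ∀ {n : ℕ} (σ : Fin n → L.Sorts) (φ : Formula L σ []) (x : ∀ i, M (σ i)),
    φ.value N (fun i => toFun (σ i) (x i)) = φ.value M x

/-- The image of a subset (a family of subsets of the sorts) under an affine embedding. -/
def AffineEmbedding.image {M : Structure.{u, v} L} {N : Structure.{u, w} L}
    (j : AffineEmbedding M N) (A : ∀ s, Set (M s)) : ∀ s, Set (N s) :=
  fun s => j.toFun s '' A s

/-- The range of an affine embedding. -/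
def AffineEmbedding.range {M : Structure.{u, v} L} {N : Structure.{u, w} L}
    (j : AffineEmbedding M N) : ∀ s, Set (N s) :=
  fun s => Set.range (j.toFun s)

/-- The image of a tuple under an affine embedding. -/
def AffineEmbedding.tuple {M : Structure.{u, v} L} {N : Structure.{u, w} L}
    (j : AffineEmbedding M N) {I : Type*} {σ : I → L.Sorts} (a : ∀ i, M (σ i)) :
    ∀ i, N (σ i) :=
  fun i => j.toFun (σ i) (a i)

/-- The sorts of the variables `x` (of sorts `σ`) together with one variable for each element of
`A`. -/
def paramSort (M : Structure.{u, w} L) (A : ∀ s, Set (M s)) {I : Type v} (σ : I → L.Sorts) :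
    I ⊕ (Σ s, A s) → L.Sorts
  | .inl i => σ i
  | .inr p => p.1

/-- The tuple `a` followed by the enumeration of `A` by itself. -/
def withParams (M : Structure.{u, w} L) (A : ∀ s, Set (M s)) {I : Type v} {σ : I → L.Sorts}
    (a : ∀ i, M (σ i)) : ∀ k, M (paramSort M A σ k)
  | .inl i => a i
  | .inr p => p.2.1

/-- Equality over `A` of the affine types of two (possibly infinite) tuples `a` and `b` of the same
sorts in `M`: all affine formulas with parameters in `A` have the same value at `a` and at `b`. -/
def TypeEqOver (M : Structure.{u, w} L) (A : ∀ s, Set (M s)) {I : Type v} {σ : I → L.Sorts}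
    (a b : ∀ i, M (σ i)) : Prop :=
  ∀ φ : Formula L (paramSort M A σ) [],
    φ.value M (withParams M A a) = φ.value M (withParams M A b)

/-- The tuple `e` enumerates (possibly with repetitions) the subset `B` of `M`. -/
def Enumerates (M : Structure.{u, w} L) {I : Type v} {σ : I → L.Sorts} (e : ∀ i, M (σ i))
    (B : ∀ s, Set (M s)) : Prop :=
  ∀ s (x : M s), x ∈ B s ↔ ∃ i, (⟨σ i, e i⟩ : Σ s, M s) = ⟨s, x⟩

/-- Equality over `A` of the affine types of two subsets of `M`, relative to some common
enumeration. -/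
def SetTypeEqOver (M : Structure.{u, w} L) (A B B' : ∀ s, Set (M s)) : Prop :=
  ∃ (I : Type (max u w)) (σ : I → L.Sorts) (e e' : ∀ i, M (σ i)),
    Enumerates M e B ∧ Enumerates M e' B' ∧ TypeEqOver M A e e'

end Types

section Lascar

variable {L : Signature.{u}}

/-- `a` and `b` have the same affine type over some model containing `A`, that is, over some affine
substructure of `N` containing `A`. -/
def SameTypeOverModel (N : Structure.{u, w} L) (A : ∀ s, Set (N s)) {I : Type v}
    {σ : I → L.Sorts} (a b : ∀ i, N (σ i)) : Prop :=
  ∃ (K : Structure.{u, w} L) (h : AffineEmbedding K N),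
    (∀ s, A s ⊆ h.range s) ∧ TypeEqOver N h.range a b

/-- The Lascar distance (relative to models) over `A` between `a` and `b` is at most `n`: in some
affine extension they are joined by a chain of `n` steps, each between two tuples with the same
affine type over some model containing `A`. -/
def LascarDistLE (M : Structure.{u, w} L) (A : ∀ s, Set (M s)) {I : Type v}
    {σ : I → L.Sorts} (a b : ∀ i, M (σ i)) (n : ℕ) : Prop :=
  ∃ (N : Structure.{u, max u w} L) (j : AffineEmbedding M N) (c : ℕ → ∀ i, N (σ i)),
    c 0 = j.tuple a ∧ c n = j.tuple b ∧
      ∀ k < n, SameTypeOverModel N (j.image A) (c k) (c (k + 1))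

/-- Equality of Lascar types over `A`: the transitive closure, in affine extensions, of equality of
affine types over models containing `A`. -/
def SameLascarType (M : Structure.{u, w} L) (A : ∀ s, Set (M s)) {I : Type v}
    {σ : I → L.Sorts} (a b : ∀ i, M (σ i)) : Prop :=
  ∃ n, LascarDistLE M A a b n

end Lascar

end AffineLogic

/-! Both claims come from one construction. Given an enumeration `e` of `B`, find an affine
extension containing a tuple `e'` with the affine type of `e` over `A` and such that φ(a, e') = φ(b,
e') for every affine formula φ. For B = M the tuple `e'` enumerates an affine substructure
containing `A`, and this gives Lascar distance at most one.

Extensions are built as ultrameans. For a finitely additive mean Λ on a set Y, families indexed by Y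
form a structure in which the value of an affine formula is the Λ-mean of its values
(`ultramean.eval_formula`). Take for Y the set of all tuples of `M` of the sorts of `e`, and for
`e'` the class of the identity family. The requirements on `e'` then follow if Λ annihilates all
functions y ↦ ψ(y) − ψ(e) + φ(a, y) − φ(b, y), where ψ and φ are affine over `A`. These functions
form a linear space, so by Hahn–Banach such a Λ exists as soon as each of them has nonnegative
supremum (`Mean.exists_eq_zero`).

With χ(x, x') = sup_y [ψ(y) + φ(x, y) − φ(x', y)], what remains is ψ(e) ≤ χ(a, b)
(`TypeEqOver.le_of_forall_le`). Suppose there were a chain a = x₀, x₁, …, xₙ with all χ(xᵢ, xᵢ₊₁) ≤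
χ(a, b). Summing at y = e would telescope to nψ(e) + φ(a, e) − φ(xₙ, e) ≤ nχ(a, b). As φ is bounded,
dividing by n and letting n grow would give the claim. It suffices that the minimal cost of a chain
be small: F₀ = 0 and Fₙ₊₁(x) = inf_{x'} [χ(x, x') + Fₙ(x')] are affine over `A`, hence Fₙ(a) =
Fₙ(b), and Fₙ(a) ≤ nχ(a, b) follows by induction. -/

namespace AffineLogic

/-! ### Substitution of terms in affine formulas. -/

section Substitution

universe v'

variable {L : Signature.{u}} {V : Type v} {σ : V → L.Sorts} {V' : Type v'} {σ' : V' → L.Sorts}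

/-- Simultaneous substitution of terms for the free and the bound variables of a term. -/
def Term.subst {Γ Γ' : List L.Sorts} (ρ : ∀ i, Term L σ' Γ' (σ i))
    (β : ∀ j : Fin Γ.length, Term L σ' Γ' (Γ.get j)) :
    {s : L.Sorts} → Term L σ Γ s → Term L σ' Γ' s
  | _, .free i => ρ i
  | _, .bound j => β j
  | _, .app f t => .app f fun k => (t k).subst ρ β

theorem Term.eval_subst (M : Structure.{u, w} L) {Γ Γ' : List L.Sorts}
    (ρ : ∀ i, Term L σ' Γ' (σ i)) (β : ∀ j : Fin Γ.length, Term L σ' Γ' (Γ.get j))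
    (x : ∀ i, M (σ' i)) (y : ∀ j : Fin Γ'.length, M (Γ'.get j)) {s : L.Sorts}
    (t : Term L σ Γ s) :
    (t.subst ρ β).eval M x y =
      t.eval M (fun i => (ρ i).eval M x y) (fun j => (β j).eval M x y) := by
  induction t with
  | free i => rfl
  | bound j => rfl
  | app f t ih => simp only [Term.subst, Term.eval, ih]

/-- The inclusion of the terms in a larger context of bound variables. -/
def Term.weaken {Γ : List L.Sorts} (s : L.Sorts) {s' : L.Sorts} (t : Term L σ Γ s') :
    Term L σ (s :: Γ) s' :=
  t.subst .free fun j => .bound (Γ := s :: Γ) j.succ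

theorem Term.eval_weaken (M : Structure.{u, w} L) {Γ : List L.Sorts} {s s' : L.Sorts}
    (t : Term L σ Γ s') (x : ∀ i, M (σ i)) (y : ∀ j : Fin Γ.length, M (Γ.get j)) (z : M s) :
    (t.weaken s).eval M x (extend M z y) = t.eval M x y :=
  Term.eval_subst M _ _ _ _ t

/-- The substitution under a quantifier induced by a substitution for the bound variables. -/
def liftBound {Γ Γ' : List L.Sorts} (s : L.Sorts)
    (β : ∀ j : Fin Γ.length, Term L σ' Γ' (Γ.get j)) :
    ∀ j : Fin (s :: Γ).length, Term L σ' (s :: Γ') ((s :: Γ).get j) :=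
  Fin.cons (α := fun j : Fin (Γ.length + 1) => Term L σ' (s :: Γ') ((s :: Γ).get j))
    (.bound (Γ := s :: Γ') (0 : Fin (Γ'.length + 1))) fun j => (β j).weaken s

theorem eval_liftBound (M : Structure.{u, w} L) {Γ Γ' : List L.Sorts} {s : L.Sorts}
    (β : ∀ j : Fin Γ.length, Term L σ' Γ' (Γ.get j)) (x : ∀ i, M (σ' i))
    (y : ∀ j : Fin Γ'.length, M (Γ'.get j)) (z : M s) :
    (fun j => (liftBound s β j).eval M x (extend M z y)) =
      extend M z fun j => (β j).eval M x y := by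
  funext j
  refine Fin.cases ?_ (fun j => ?_) j
  · rfl
  · exact (β j).eval_weaken M x y z

/-- Simultaneous substitution of terms for the free and the bound variables of an affine
formula. -/
def Formula.subst : {Γ : List L.Sorts} → Formula L σ Γ → {Γ' : List L.Sorts} →
    (∀ i, Term L σ' Γ' (σ i)) → (∀ j : Fin Γ.length, Term L σ' Γ' (Γ.get j)) → Formula L σ' Γ'
  | _, .pred P t, _, ρ, β => .pred P fun k => (t k).subst ρ β
  | _, .dist t₁ t₂, _, ρ, β => .dist (t₁.subst ρ β) (t₂.subst ρ β)
  | _, .const r, _, _, _ => .const r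
  | _, .add φ ψ, _, ρ, β => .add (φ.subst ρ β) (ψ.subst ρ β)
  | _, .smul r φ, _, ρ, β => .smul r (φ.subst ρ β)
  | _, .sup s φ, _, ρ, β => .sup s (φ.subst (fun i => (ρ i).weaken s) (liftBound s β))
  | _, .inf s φ, _, ρ, β => .inf s (φ.subst (fun i => (ρ i).weaken s) (liftBound s β))

theorem Formula.eval_subst (M : Structure.{u, w} L) {Γ : List L.Sorts} (φ : Formula L σ Γ)
    {Γ' : List L.Sorts} (ρ : ∀ i, Term L σ' Γ' (σ i))
    (β : ∀ j : Fin Γ.length, Term L σ' Γ' (Γ.get j))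
    (x : ∀ i, M (σ' i)) (y : ∀ j : Fin Γ'.length, M (Γ'.get j)) :
    (φ.subst ρ β).eval M x y =
      φ.eval M (fun i => (ρ i).eval M x y) (fun j => (β j).eval M x y) := by
  induction φ generalizing Γ' with
  | pred P t => simp only [Formula.subst, Formula.eval, Term.eval_subst]
  | dist t₁ t₂ => simp only [Formula.subst, Formula.eval, Term.eval_subst]
  | const r => rfl
  | add φ ψ ihφ ihψ => simp only [Formula.subst, Formula.eval, ihφ, ihψ]
  | smul r φ ih => simp only [Formula.subst, Formula.eval, ih]
  | sup s φ ih => simp only [Formula.subst, Formula.eval, ih, Term.eval_weaken, eval_liftBound]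
  | inf s φ ih => simp only [Formula.subst, Formula.eval, ih, Term.eval_weaken, eval_liftBound]

/-- Substitution of terms for the free variables of a formula without bound variables. -/
def Formula.substFree {Γ' : List L.Sorts} (φ : Formula L σ []) (ρ : ∀ i, Term L σ' Γ' (σ i)) :
    Formula L σ' Γ' :=
  φ.subst ρ fun j : Fin 0 => j.elim0

theorem Formula.eval_substFree (M : Structure.{u, w} L) {Γ' : List L.Sorts}
    (φ : Formula L σ []) (ρ : ∀ i, Term L σ' Γ' (σ i)) (x : ∀ i, M (σ' i))
    (y : ∀ j : Fin Γ'.length, M (Γ'.get j)) :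
    (φ.substFree ρ).eval M x y = φ.value M fun i => (ρ i).eval M x y := by
  rw [Formula.substFree, Formula.eval_subst, Formula.value]
  congr 1
  exact funext fun j => j.elim0

theorem Formula.value_substFree (M : Structure.{u, w} L) (φ : Formula L σ [])
    (ρ : ∀ i, Term L σ' [] (σ i)) (x : ∀ i, M (σ' i)) :
    (φ.substFree ρ).value M x = φ.value M fun i => (ρ i).eval M x fun j : Fin 0 => j.elim0 :=
  φ.eval_substFree M ρ x _

end Substitution

/-! ### Boundedness of affine formulas. -/

section Bounds

variable {L : Signature.{u}} {V : Type v} {σ : V → L.Sorts}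

instance (M : Structure.{u, w} L) (s : L.Sorts) : Nonempty (M s) := M.nonempty s

instance (M : Structure.{u, w} L) (s : L.Sorts) : CompleteSpace (M s) := M.complete s

theorem Structure.dist_le (M : Structure.{u, w} L) {s : L.Sorts} (x y : M s) :
    dist x y ≤ L.diam s := M.nndist_le s x y

/-- Every affine formula is bounded. -/
theorem Formula.exists_abs_eval_le (M : Structure.{u, w} L) {Γ : List L.Sorts}
    (φ : Formula L σ Γ) : ∃ C : ℝ, ∀ x y, |φ.eval M x y| ≤ C := by
  induction φ with
  | pred P t =>
    refine ⟨max |L.predLower P| |L.predUpper P|, fun x y => ?_⟩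
    have h := M.pred_mem P fun k => (t k).eval M x y
    exact abs_le_max_abs_abs h.1 h.2
  | @dist _ s t₁ t₂ =>
    refine ⟨L.diam s, fun x y => ?_⟩
    rw [Formula.eval, abs_of_nonneg dist_nonneg]
    exact M.dist_le _ _
  | const r => exact ⟨|r|, fun x y => le_rfl⟩
  | add φ ψ ihφ ihψ =>
    obtain ⟨C, hC⟩ := ihφ
    obtain ⟨D, hD⟩ := ihψ
    exact ⟨C + D, fun x y => (abs_add_le _ _).trans (add_le_add (hC x y) (hD x y))⟩
  | smul r φ ih =>
    obtain ⟨C, hC⟩ := ih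
    refine ⟨|r| * C, fun x y => ?_⟩
    rw [Formula.eval, abs_mul]
    exact mul_le_mul_of_nonneg_left (hC x y) (abs_nonneg r)
  | sup s φ ih =>
    obtain ⟨C, hC⟩ := ih
    refine ⟨C, fun x y => abs_le.2 ⟨?_, ciSup_le fun z => (abs_le.1 (hC x _)).2⟩⟩
    refine (abs_le.1 (hC x (extend M (Classical.arbitrary _) y))).1.trans (le_ciSup
      (f := fun z => φ.eval M x (extend M z y)) ⟨C, ?_⟩ _)
    rintro _ ⟨z, rfl⟩
    exact (abs_le.1 (hC x _)).2
  | inf s φ ih =>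
    obtain ⟨C, hC⟩ := ih
    refine ⟨C, fun x y => abs_le.2 ⟨le_ciInf fun z => (abs_le.1 (hC x _)).1, ?_⟩⟩
    refine (ciInf_le (f := fun z => φ.eval M x (extend M z y)) ⟨-C, ?_⟩ _).trans
      (abs_le.1 (hC x (extend M (Classical.arbitrary _) y))).2
    rintro _ ⟨z, rfl⟩
    exact (abs_le.1 (hC x _)).1

theorem Formula.bddBelow_eval (M : Structure.{u, w} L) {Γ : List L.Sorts} {s : L.Sorts}
    (φ : Formula L σ (s :: Γ)) (x : ∀ i, M (σ i)) (y : ∀ j : Fin Γ.length, M (Γ.get j)) :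
    BddBelow (Set.range fun z => φ.eval M x (extend M z y)) := by
  obtain ⟨C, hC⟩ := φ.exists_abs_eval_le M
  refine ⟨-C, ?_⟩
  rintro _ ⟨z, rfl⟩
  exact (abs_le.1 (hC x _)).1

end Bounds

/-! ### Reduction to finitely many free variables. -/

section FiniteSupport

variable {L : Signature.{u}} {V : Type v} {σ : V → L.Sorts}

/-- Every term has finitely many free variables. -/
theorem Term.exists_finset {Γ : List L.Sorts} {s : L.Sorts} (t : Term L σ Γ s) :
    ∃ F : Finset V, ∀ G : Finset V, F ⊆ G → ∃ t' : Term L (fun i : G => σ i) Γ s,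
      ∀ (M : Structure.{u, w} L) x y, t'.eval M (fun i => x i) y = t.eval M x y := by
  classical
  induction t with
  | free i =>
    exact ⟨{i}, fun G hG => ⟨.free (σ := fun i : G => σ i) ⟨i, hG (by simp)⟩,
      fun M x y => rfl⟩⟩
  | bound j => exact ⟨∅, fun G _ => ⟨.bound j, fun M x y => rfl⟩⟩
  | app f t ih =>
    choose F hF using ih
    -- Since the claim is made for every `G` containing the support, a single `G` serves all
    -- arguments at once.
    refine ⟨Finset.univ.biUnion F, fun G hG => ?_⟩
    choose t' ht' using fun k =>
      hF k G ((Finset.subset_biUnion_of_mem F (Finset.mem_univ k)).trans hG)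
    exact ⟨.app f t', fun M x y => by simp only [Term.eval, ht']⟩

/-- Every affine formula has finitely many free variables. -/
theorem Formula.exists_finset {Γ : List L.Sorts} (φ : Formula L σ Γ) :
    ∃ F : Finset V, ∀ G : Finset V, F ⊆ G → ∃ φ' : Formula L (fun i : G => σ i) Γ,
      ∀ (M : Structure.{u, w} L) x y, φ'.eval M (fun i => x i) y = φ.eval M x y := by
  classical
  induction φ with
  | pred P t =>
    choose F hF using fun k => Term.exists_finset.{u, v, w} (t k)
    refine ⟨Finset.univ.biUnion F, fun G hG => ?_⟩
    choose t' ht' using fun k =>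
      hF k G ((Finset.subset_biUnion_of_mem F (Finset.mem_univ k)).trans hG)
    exact ⟨.pred P t', fun M x y => by simp only [Formula.eval, ht']⟩
  | dist t₁ t₂ =>
    obtain ⟨F₁, h₁⟩ := Term.exists_finset.{u, v, w} t₁
    obtain ⟨F₂, h₂⟩ := Term.exists_finset.{u, v, w} t₂
    refine ⟨F₁ ∪ F₂, fun G hG => ?_⟩
    obtain ⟨t₁', ht₁⟩ := h₁ G (Finset.union_subset_left hG)
    obtain ⟨t₂', ht₂⟩ := h₂ G (Finset.union_subset_right hG)
    exact ⟨.dist t₁' t₂', fun M x y => by simp only [Formula.eval, ht₁, ht₂]⟩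
  | const r => exact ⟨∅, fun G _ => ⟨.const r, fun M x y => rfl⟩⟩
  | add φ ψ ihφ ihψ =>
    obtain ⟨F₁, h₁⟩ := ihφ
    obtain ⟨F₂, h₂⟩ := ihψ
    refine ⟨F₁ ∪ F₂, fun G hG => ?_⟩
    obtain ⟨φ', hφ⟩ := h₁ G (Finset.union_subset_left hG)
    obtain ⟨ψ', hψ⟩ := h₂ G (Finset.union_subset_right hG)
    exact ⟨.add φ' ψ', fun M x y => by simp only [Formula.eval, hφ, hψ]⟩
  | smul r φ ih =>
    obtain ⟨F, h⟩ := ih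
    refine ⟨F, fun G hG => ?_⟩
    obtain ⟨φ', hφ⟩ := h G hG
    exact ⟨.smul r φ', fun M x y => by simp only [Formula.eval, hφ]⟩
  | sup s φ ih =>
    obtain ⟨F, h⟩ := ih
    refine ⟨F, fun G hG => ?_⟩
    obtain ⟨φ', hφ⟩ := h G hG
    exact ⟨.sup s φ', fun M x y => by simp only [Formula.eval, hφ]⟩
  | inf s φ ih =>
    obtain ⟨F, h⟩ := ih
    refine ⟨F, fun G hG => ?_⟩
    obtain ⟨φ', hφ⟩ := h G hG
    exact ⟨.inf s φ', fun M x y => by simp only [Formula.eval, hφ]⟩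

end FiniteSupport

/-! ### Infima over tuples of variables as affine formulas. -/

section Elimination

universe v'

variable {L : Signature.{u}} {I : Type v} {σ : I → L.Sorts}

/-- The concatenation of two tuples. -/
def pair {M : Structure.{u, w} L} {K : Type v'} {τ : K → L.Sorts} (x : ∀ i, M (σ i))
    (y : ∀ k, M (τ k)) : ∀ i, M (Sum.elim σ τ i)
  | .inl i => x i
  | .inr k => y k

/-- The infimum of an affine formula over a finite tuple of variables is an affine formula. -/
theorem Formula.exists_isGLB_of_finite (W : Type v') [Finite W] :
    ∀ (κ : W → L.Sorts) (φ : Formula L (Sum.elim σ κ) []),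
      ∃ ψ : Formula L σ [], ∀ (M : Structure.{u, w} L) (x : ∀ i, M (σ i)),
        IsGLB (Set.range fun y : ∀ k, M (κ k) => φ.value M (pair x y)) (ψ.value M x) := by
  induction W using Finite.induction_empty_option with
  | @of_equiv W W' e ih =>
    intro κ φ
    obtain ⟨ψ, hψ⟩ := ih (κ ∘ e) (φ.substFree
      (Sum.rec (fun i => .free (σ := Sum.elim σ (κ ∘ e)) (.inl i)) fun k =>
        (e.apply_symm_apply k) ▸ .free (σ := Sum.elim σ (κ ∘ e)) (.inr (e.symm k))))
    refine ⟨ψ, fun M x => ?_⟩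
    -- Stated for an arbitrary `j` with `e j = k`, so that the transport along this equation can be
    -- removed by eliminating it.
    have key : ∀ (y : ∀ k, M (κ k)) (k : W') (j : W) (h : e j = k),
        Term.eval M (pair x fun k => y (e k)) (Γ := []) (fun j => j.elim0)
          (h ▸ .free (σ := Sum.elim σ (κ ∘ e)) (.inr j) : Term L (Sum.elim σ (κ ∘ e)) [] (κ k)) =
            y k := by
      rintro y _ j rfl
      rfl
    have hval : ∀ y : ∀ k, M (κ k), φ.value M (pair x y) = (φ.substFree
        (Sum.rec (fun i => .free (σ := Sum.elim σ (κ ∘ e)) (.inl i)) fun k =>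
          (e.apply_symm_apply k) ▸ .free (σ := Sum.elim σ (κ ∘ e)) (.inr (e.symm k)))).value M
            (pair x fun k => y (e k)) := by
      intro y
      rw [Formula.value_substFree]
      congr 1
      funext i
      rcases i with i | k
      · rfl
      · exact (key y k _ (e.apply_symm_apply k)).symm
    convert hψ M x using 1
    ext r
    constructor
    · rintro ⟨y, rfl⟩
      exact ⟨fun k => y (e k), (hval y).symm⟩
    · rintro ⟨z, rfl⟩
      refine ⟨Equiv.piCongrLeft (fun k => M (κ k)) e z, (hval _).trans ?_⟩
      congr 2
      funext k
      exact Equiv.piCongrLeft_apply_apply (fun k => M (κ k)) e z k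
  | h_empty =>
    intro κ φ
    refine ⟨φ.substFree (Sum.rec (fun i => .free i) fun k => k.elim), fun M x => ?_⟩
    have : (fun y : ∀ k, M (κ k) => φ.value M (pair x y)) = fun _ =>
        (φ.substFree (Sum.rec (fun i => .free i) fun k => k.elim)).value M x := by
      funext y
      rw [Formula.value_substFree]
      congr 1
      funext i
      rcases i with i | k
      · rfl
      · exact k.elim
    rw [this, Set.range_const]
    exact isGLB_singleton
  | @h_option W _ ih =>
    intro κ φ
    -- The variable indexed by `none` becomes the bound variable of one `inf` quantifier; the
    -- induction hypothesis takes care of the others.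
    obtain ⟨ψ, hψ⟩ := ih (κ ∘ some) (.inf (κ none) (φ.substFree (Sum.rec
      (fun i => .free (σ := Sum.elim σ (κ ∘ some)) (.inl i)) fun k => match k with
        | none => .bound (Γ := [κ none]) (0 : Fin 1)
        | some k => .free (σ := Sum.elim σ (κ ∘ some)) (.inr k))))
    refine ⟨ψ, fun M x => ?_⟩
    have hval : ∀ (y : ∀ k, M (κ k)) (v), Formula.eval M (pair x fun k => y (some k))
        (φ.substFree (Sum.rec
          (fun i => .free (σ := Sum.elim σ (κ ∘ some)) (.inl i)) fun k => match k with
            | none => .bound (Γ := [κ none]) (0 : Fin 1)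
            | some k => .free (σ := Sum.elim σ (κ ∘ some)) (.inr k)))
          (extend M (y none) v) = φ.value M (pair x y) := by
      intro y v
      rw [Formula.eval_substFree]
      congr 1
      funext i
      rcases i with i | k | k <;> rfl
    constructor
    · rintro _ ⟨y, rfl⟩
      refine ((hψ M x).1 ⟨fun k => y (some k), rfl⟩).trans ?_
      refine (ciInf_le (Formula.bddBelow_eval M _ _ _) (y none)).trans ?_
      exact (hval y _).le
    · intro r hr
      refine (hψ M x).2 ?_
      rintro _ ⟨y, rfl⟩
      refine le_ciInf fun z => ?_
      have h := hr ⟨fun k => match k with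
        | none => z
        | some k => y k, rfl⟩
      exact h.trans (hval (fun k => match k with
        | none => z
        | some k => y k) _).ge

/-- The infimum of an affine formula over a possibly infinite tuple of variables is an affine
formula. -/
theorem Formula.exists_isGLB {K : Type v'} {τ : K → L.Sorts} (φ : Formula L (Sum.elim σ τ) []) :
    ∃ ψ : Formula L σ [], ∀ (M : Structure.{u, w} L) (x : ∀ i, M (σ i)),
      IsGLB (Set.range fun y : ∀ k, M (τ k) => φ.value M (pair x y)) (ψ.value M x) := by
  classical
  obtain ⟨F, hF⟩ := Formula.exists_finset.{u, max v v', w} φ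
  obtain ⟨φ', hφ⟩ := hF F le_rfl
  let W := {k : K // Sum.inr k ∈ F}
  have : Finite W := Finite.of_injective (fun k : W => (⟨_, k.2⟩ : F)) fun k l h =>
    Subtype.ext (Sum.inr_injective (congrArg Subtype.val h))
  let ρ : ∀ i : F, Term L (Sum.elim σ fun k : W => τ k) [] (Sum.elim σ τ i) := fun i =>
    match i with
    | ⟨.inl i, _⟩ => .free (σ := Sum.elim σ fun k : W => τ k) (.inl i)
    | ⟨.inr k, h⟩ => .free (σ := Sum.elim σ fun k : W => τ k) (.inr ⟨k, h⟩)
  obtain ⟨ψ, hψ⟩ := Formula.exists_isGLB_of_finite.{u, v, w, v'} W (fun k => τ k) (φ'.substFree ρ)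
  refine ⟨ψ, fun M x => ?_⟩
  have hval : ∀ y : ∀ k, M (τ k),
      (φ'.substFree ρ).value M (pair x fun k : W => y k) = φ.value M (pair x y) := by
    intro y
    rw [Formula.value_substFree]
    refine Eq.trans ?_ (hφ M (pair x y) _)
    rw [Formula.value]
    congr 1
    funext i
    rcases i with ⟨i | k, h⟩ <;> rfl
  convert hψ M x using 1
  ext r
  constructor
  · rintro ⟨y, rfl⟩
    exact ⟨fun k => y k, hval y⟩
  · rintro ⟨z, rfl⟩
    -- The values outside `F` do not affect the formula; some value exists because every sort is
    -- nonempty.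
    refine ⟨fun k => if h : Sum.inr k ∈ F then z ⟨k, h⟩ else Classical.arbitrary _,
      (hval _).symm.trans ?_⟩
    congr 2
    funext k
    exact dif_pos k.2

end Elimination

/-! ### Finitely additive means, Jensen's inequality and Hahn–Banach. -/

section Means

/-- A finitely additive probability integral on the bounded functions on `Y` (extended in an
arbitrary linear way to the unbounded ones). -/
structure Mean (Y : Type v) where
  toLinearMap : (Y → ℝ) →ₗ[ℝ] ℝ
  le_of_le' : ∀ (f : Y → ℝ) (C D : ℝ), (∀ i, |f i| ≤ D) → (∀ i, f i ≤ C) → toLinearMap f ≤ C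

variable {Y : Type v}

instance : CoeFun (Mean Y) (fun _ => (Y → ℝ) → ℝ) := ⟨fun Λ => Λ.toLinearMap⟩

namespace Mean

variable (Λ : Mean Y)

theorem map_add (f g : Y → ℝ) : Λ (fun i => f i + g i) = Λ f + Λ g :=
  Λ.toLinearMap.map_add f g

theorem map_sub (f g : Y → ℝ) : Λ (fun i => f i - g i) = Λ f - Λ g :=
  Λ.toLinearMap.map_sub f g

theorem map_neg (f : Y → ℝ) : Λ (fun i => -f i) = -Λ f :=
  Λ.toLinearMap.map_neg f

theorem map_mul (r : ℝ) (f : Y → ℝ) : Λ (fun i => r * f i) = r * Λ f :=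
  Λ.toLinearMap.map_smul r f

theorem le_of_le {f : Y → ℝ} {C D : ℝ} (hf : ∀ i, |f i| ≤ D) (h : ∀ i, f i ≤ C) : Λ f ≤ C :=
  Λ.le_of_le' f C D hf h

theorem le_of_ge {f : Y → ℝ} {C D : ℝ} (hf : ∀ i, |f i| ≤ D) (h : ∀ i, C ≤ f i) : C ≤ Λ f := by
  have := Λ.le_of_le (f := fun i => -f i) (C := -C) (D := D) (by simpa using hf)
    fun i => neg_le_neg (h i)
  rw [Λ.map_neg] at this
  linarith

theorem map_const (c : ℝ) : Λ (fun _ => c) = c :=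
  le_antisymm (Λ.le_of_le (fun _ => le_rfl) fun _ => le_rfl)
    (Λ.le_of_ge (fun _ => le_rfl) fun _ => le_rfl)

theorem mono {f g : Y → ℝ} {C D : ℝ} (hf : ∀ i, |f i| ≤ C) (hg : ∀ i, |g i| ≤ D)
    (h : ∀ i, f i ≤ g i) : Λ f ≤ Λ g := by
  have := Λ.le_of_le (f := fun i => f i - g i) (C := 0) (D := C + D)
    (fun i => (abs_sub _ _).trans (add_le_add (hf i) (hg i))) fun i => sub_nonpos.2 (h i)
  rw [Λ.map_sub] at this
  linarith

/-- The vector of the means of finitely many bounded functions lies in every closed convex set that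
contains all the vectors of their values. -/
theorem mem_of_convex {n : ℕ} (f : Y → Fin n → ℝ) (g : Y → ℝ) {C D : ℝ}
    (hf : ∀ i k, |f i k| ≤ C) (hg : ∀ i, |g i| ≤ D) {S : Set ((Fin n → ℝ) × ℝ)}
    (hconv : Convex ℝ S) (hclosed : IsClosed S) (hS : ∀ i, (f i, g i) ∈ S) :
    ((fun k => Λ fun i => f i k), Λ g) ∈ S := by
  by_contra hnot
  -- A functional separating the mean vector from `S` is a finite linear combination of coordinates,
  -- hence commutes with the mean. It is below `r` at every vector of values, so its mean is at most
  -- `r`, a contradiction.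
  obtain ⟨ℓ, r, hlt, hgt⟩ := geometric_hahn_banach_closed_point hconv hclosed hnot
  have hℓ : ∀ (x : Fin n → ℝ) (t : ℝ),
      ℓ (x, t) = ∑ k, ℓ (Pi.single k 1, 0) * x k + ℓ (0, 1) * t := by
    intro x t
    have h : ((x, t) : (Fin n → ℝ) × ℝ) =
        ∑ k, x k • ((Pi.single k 1 : Fin n → ℝ), (0 : ℝ)) + t • ((0 : Fin n → ℝ), (1 : ℝ)) := by
      ext j
      · simp [Prod.fst_sum, Finset.sum_apply, Pi.single_apply]
      · simp [Prod.snd_sum]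
    rw [h, _root_.map_add, map_sum, map_smul]
    simp only [map_smul, smul_eq_mul, mul_comm]
  have hsum : Λ (fun i => ℓ (f i, g i)) = ℓ ((fun k => Λ fun i => f i k), Λ g) := by
    have h : (fun i => ℓ (f i, g i)) =
        ∑ k, ℓ (Pi.single k 1, 0) • (fun i => f i k) + ℓ (0, 1) • g := by
      funext i
      simp only [hℓ (f i), Pi.add_apply, Finset.sum_apply, Pi.smul_apply, smul_eq_mul]
    rw [h, hℓ fun k => Λ fun i => f i k, _root_.map_add, map_sum]
    simp only [map_smul, smul_eq_mul]
  refine hgt.not_ge (hsum ▸ Λ.le_of_le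
    (D := ∑ k, |ℓ (Pi.single k 1, 0)| * C + |ℓ (0, 1)| * D) (fun i => ?_) fun i => (hlt _ (hS i)).le)
  rw [hℓ]
  refine (abs_add_le _ _).trans (add_le_add ((Finset.abs_sum_le_sum_abs _ _).trans
    (Finset.sum_le_sum fun k _ => ?_)) ?_)
  · rw [abs_mul]
    exact mul_le_mul_of_nonneg_left (hf i k) (abs_nonneg _)
  · rw [abs_mul]
    exact mul_le_mul_of_nonneg_left (hg i) (abs_nonneg _)

/-- Jensen's inequality for concave moduli of uniform continuity. -/
theorem le_modulus {n : ℕ} (Δ : Modulus n) (f : Y → Fin n → ℝ≥0) (g : Y → ℝ) {C D : ℝ}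
    (hf : ∀ i k, (f i k : ℝ) ≤ C) (hg : ∀ i, |g i| ≤ D) (h : ∀ i, g i ≤ Δ (f i)) :
    Λ g ≤ Δ fun k => Real.toNNReal (Λ fun i => f i k) := by
  -- The hypograph of the modulus over the nonnegative orthant: convex because `Δ` is concave,
  -- closed because `Δ` is continuous.
  let S : Set ((Fin n → ℝ) × ℝ) :=
    {p | (∀ k, 0 ≤ p.1 k) ∧ p.2 ≤ Δ fun k => Real.toNNReal (p.1 k)}
  have hconv : Convex ℝ S := by
    rintro ⟨x, s⟩ ⟨hx, hs⟩ ⟨y, t⟩ ⟨hy, ht⟩ a b ha hb hab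
    refine ⟨fun k => add_nonneg (mul_nonneg ha (hx k)) (mul_nonneg hb (hy k)), ?_⟩
    lift a to ℝ≥0 using ha
    lift b to ℝ≥0 using hb
    have hc := Δ.concave.2 (Set.mem_univ fun k => Real.toNNReal (x k))
      (Set.mem_univ fun k => Real.toNNReal (y k)) a.2 b.2 (by exact_mod_cast hab)
    have he : (a • (fun k => Real.toNNReal (x k)) + b • fun k => Real.toNNReal (y k)) =
        fun k => Real.toNNReal (((a : ℝ) • (x, s) + (b : ℝ) • (y, t)).1 k) := by
      funext k
      apply NNReal.eq
      have h0 : 0 ≤ (a : ℝ) * x k + b * y k :=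
        add_nonneg (mul_nonneg a.2 (hx k)) (mul_nonneg b.2 (hy k))
      simp [Real.coe_toNNReal _ (hx k), Real.coe_toNNReal _ (hy k), h0]
    change (a : ℝ) * s + b * t ≤ _
    rw [← he]
    refine le_trans ?_ (NNReal.coe_le_coe.2 hc)
    push_cast [smul_eq_mul]
    exact add_le_add (mul_le_mul_of_nonneg_left hs a.2) (mul_le_mul_of_nonneg_left ht b.2)
  have hclosed : IsClosed S := by
    refine (isClosed_le continuous_const continuous_fst :
      IsClosed {p : (Fin n → ℝ) × ℝ | 0 ≤ p.1}).inter (isClosed_le continuous_snd ?_)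
    exact NNReal.continuous_coe.comp (Δ.continuous.comp (continuous_pi fun k =>
      continuous_real_toNNReal.comp ((continuous_apply k).comp continuous_fst)))
  exact (Λ.mem_of_convex (fun i k => (f i k : ℝ)) g (C := C) (by simpa using hf) hg hconv hclosed
    fun i => ⟨fun k => (f i k).2, by simpa using h i⟩).2

/-- A linear space of bounded functions with nonnegative suprema is annihilated by some mean. -/
theorem exists_eq_zero [Nonempty Y] (W : Submodule ℝ (Y → ℝ)) (hW : ∀ f ∈ W, ∃ D, ∀ i, |f i| ≤ D)
    (h : ∀ f ∈ W, ∀ C, (∀ i, f i ≤ C) → 0 ≤ C) : ∃ Λ : Mean Y, ∀ f ∈ W, Λ f = 0 := by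
  let E : Submodule ℝ (Y → ℝ) :=
    { carrier := {f | ∃ D, ∀ i, |f i| ≤ D}
      zero_mem' := ⟨0, fun i => by simp⟩
      add_mem' := by
        rintro f g ⟨C, hC⟩ ⟨D, hD⟩
        exact ⟨C + D, fun i => (abs_add_le _ _).trans (add_le_add (hC i) (hD i))⟩
      smul_mem' := by
        rintro r f ⟨C, hC⟩
        exact ⟨|r| * C, fun i => (abs_mul r (f i)).le.trans
          (mul_le_mul_of_nonneg_left (hC i) (abs_nonneg r))⟩ }
  have hbdd : ∀ f : E, BddAbove (Set.range f.1) := by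
    rintro ⟨f, D, hD⟩
    refine ⟨D, ?_⟩
    rintro _ ⟨i, rfl⟩
    exact (abs_le.1 (hD i)).2
  -- On bounded functions the supremum is sublinear, and by hypothesis it dominates the zero
  -- functional on `W`. An extension dominated by the supremum is a mean.
  obtain ⟨g, hg, hle⟩ := exists_extension_of_le_sublinear
    (⟨W.comap E.subtype, 0⟩ : E →ₗ.[ℝ] ℝ) (fun f => ⨆ i, f.1 i)
    (fun c hc f => (Real.mul_iSup_of_nonneg hc.le _).symm)
    (fun f g => ciSup_le fun i => add_le_add (le_ciSup (hbdd f) i) (le_ciSup (hbdd g) i))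
    (fun f => h f.1.1 f.2 _ fun i => le_ciSup (hbdd f.1) i)
  -- The values at unbounded functions are immaterial; any linear extension will do.
  obtain ⟨Λ, hΛ⟩ := g.exists_extend
  have hext : ∀ f (hf : f ∈ E), Λ f = g ⟨f, hf⟩ := fun f hf => LinearMap.congr_fun hΛ ⟨f, hf⟩
  refine ⟨⟨Λ, fun f C D hD hC => ?_⟩, fun f hf => ?_⟩
  · rw [hext f ⟨D, hD⟩]
    exact (hle _).trans (ciSup_le hC)
  · exact (hext f (hW f hf)).trans (hg ⟨⟨f, hW f hf⟩, hf⟩)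

end Mean

end Means

/-! ### Extending maps with a modulus to completions. -/

section Extension

open UniformSpace

theorem Modulus.exists_delta {n : ℕ} (Δ : Modulus n) {ε : ℝ} (hε : 0 < ε) :
    ∃ δ > 0, ∀ r : Fin n → ℝ≥0, (∀ k, (r k : ℝ) < δ) → (Δ r : ℝ) < ε := by
  have h := Δ.continuous.continuousAt (x := 0)
  rw [Metric.continuousAt_iff] at h
  obtain ⟨δ, hδ, h⟩ := h ε hε
  refine ⟨δ, hδ, fun r hr => ?_⟩
  have := h (x := r) ((dist_pi_lt_iff hδ).2 fun k => by simpa [NNReal.dist_eq] using hr k)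
  rw [Δ.map_zero, NNReal.dist_eq] at this
  simpa using this

/-- A map that respects a modulus of uniform continuity extends to the completions. -/
theorem exists_extension_completion {n : ℕ} {X : Fin n → Type v} [∀ k, PseudoMetricSpace (X k)]
    {Z : Type w} [MetricSpace Z] [CompleteSpace Z] (Δ : Modulus n) (g : (∀ k, X k) → Z)
    (hg : ∀ x y, nndist (g x) (g y) ≤ Δ fun k => nndist (x k) (y k)) :
    ∃ G : (∀ k, Completion (X k)) → Z, Continuous G ∧ (∀ x : ∀ k, X k, G (fun k => x k) = g x) ∧
      ∀ x y, nndist (G x) (G y) ≤ Δ fun k => nndist (x k) (y k) := by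
  let e : (∀ k, X k) → ∀ k, Completion (X k) := Pi.map fun k x => (x : Completion (X k))
  have he : Isometry e := Isometry.piMap _ fun k => Completion.coe_isometry
  have hd : DenseRange e := DenseRange.piMap fun k => Completion.denseRange_coe
  have hdi : IsDenseInducing e := he.isUniformInducing.isDenseInducing hd
  have hu : UniformContinuous g := by
    refine Metric.uniformContinuous_iff.2 fun ε hε => ?_
    obtain ⟨δ, hδ, h⟩ := Δ.exists_delta hε
    refine ⟨δ, hδ, fun {x y} hxy => ?_⟩
    refine lt_of_le_of_lt (NNReal.coe_le_coe.2 (hg x y)) (h _ fun k => ?_)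
    exact lt_of_le_of_lt (dist_le_pi_dist x y k) hxy
  have hc : Continuous (hdi.extend g) :=
    (uniformContinuous_uniformly_extend he.isUniformInducing hd hu).continuous
  have heq : ∀ x, hdi.extend g (e x) = g x := hdi.extend_eq hu.continuous
  refine ⟨hdi.extend g, hc, heq, fun x y => ?_⟩
  refine isClosed_property2 hd (p := fun x y => nndist (hdi.extend g x) (hdi.extend g y) ≤
    Δ fun k => nndist (x k) (y k)) ?_ (fun x y => ?_) x y
  · refine isClosed_le (by fun_prop) (Δ.continuous.comp (by fun_prop))
  · rw [heq, heq]
    refine (hg x y).trans (le_of_eq ?_)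
    congr 1
    funext k
    exact (Completion.coe_isometry.nndist_eq (x k) (y k)).symm

end Extension

/-! ### Uniform continuity of affine formulas. -/

section Continuity

variable {L : Signature.{u}} {V : Type v} {σ : V → L.Sorts}

theorem exists_pos_forall_lt {K : Type w} [Finite K] {δ : K → ℝ} (hδ : ∀ k, 0 < δ k) :
    ∃ r > 0, ∀ k, r < δ k := by
  have h : ∀ᶠ r in nhdsWithin (0 : ℝ) (Set.Ioi 0), 0 < r ∧ ∀ k, r < δ k :=
    Filter.Eventually.and self_mem_nhdsWithin (Filter.eventually_all.2 fun k =>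
      nhdsWithin_le_nhds (Iio_mem_nhds (hδ k)))
  exact h.exists

theorem Term.uniformContinuous_bound (M : Structure.{u, w} L) {Γ : List L.Sorts} {s : L.Sorts}
    (t : Term L σ Γ s) (x : ∀ i, M (σ i)) :
    ∀ ε > 0, ∃ δ > 0, ∀ y y' : ∀ j : Fin Γ.length, M (Γ.get j),
      (∀ j, dist (y j) (y' j) < δ) → dist (t.eval M x y) (t.eval M x y') < ε := by
  induction t with
  | free i => exact fun ε hε => ⟨1, one_pos, fun y y' _ => by simpa [Term.eval] using hε⟩
  | bound j => exact fun ε hε => ⟨ε, hε, fun y y' h => h j⟩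
  | app f t ih =>
    intro ε hε
    obtain ⟨η, hη, h⟩ := (L.funcModulus f).exists_delta hε
    choose δ hδ hd using fun k => ih k η hη
    obtain ⟨δ', hδ', hle⟩ := exists_pos_forall_lt hδ
    refine ⟨δ', hδ', fun y y' hy => ?_⟩
    refine lt_of_le_of_lt (NNReal.coe_le_coe.2 (M.func_modulus f _ _)) (h _ fun k => ?_)
    exact hd k y y' fun j => (hy j).trans (hle k)

/-- Bounded real functions that are uniformly close to each other have close suprema. -/
theorem abs_ciSup_sub_ciSup_le {Z : Type w} [Nonempty Z] {f g : Z → ℝ} {ε : ℝ}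
    (hf : BddAbove (Set.range f)) (hg : BddAbove (Set.range g)) (h : ∀ z, |f z - g z| ≤ ε) :
    |(⨆ z, f z) - ⨆ z, g z| ≤ ε := by
  refine abs_sub_le_iff.2 ⟨sub_le_iff_le_add.2 (ciSup_le fun z => ?_),
    sub_le_iff_le_add.2 (ciSup_le fun z => ?_)⟩
  · have := le_ciSup hg z
    linarith [(abs_sub_le_iff.1 (h z)).1]
  · have := le_ciSup hf z
    linarith [(abs_sub_le_iff.1 (h z)).2]

theorem Formula.bddAbove_eval (M : Structure.{u, w} L) {Γ : List L.Sorts} {s : L.Sorts}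
    (φ : Formula L σ (s :: Γ)) (x : ∀ i, M (σ i)) (y : ∀ j : Fin Γ.length, M (Γ.get j)) :
    BddAbove (Set.range fun z => φ.eval M x (extend M z y)) := by
  obtain ⟨C, hC⟩ := φ.exists_abs_eval_le M
  refine ⟨C, ?_⟩
  rintro _ ⟨z, rfl⟩
  exact (abs_le.1 (hC x _)).2

/-- An infimum of real numbers as a supremum. -/
theorem iInf_eq_neg_iSup_neg {Z : Type w} (f : Z → ℝ) : ⨅ z, f z = -⨆ z, -f z := by
  rw [iInf, iSup, Real.sInf_def]
  congr 2
  ext r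
  simp only [Set.mem_neg, Set.mem_range]
  exact exists_congr fun z => ⟨fun h => by rw [h, neg_neg], fun h => by rw [← h, neg_neg]⟩

/-- The `δ` does not depend on the assignment of the bound variables, and this is what lets the
estimate pass through quantifiers. Continuity in a quantified variable is needed because quantifiers
in an ultramean range over a completion, while values are known only on the dense set of families.
-/
theorem Formula.uniformContinuous_bound (M : Structure.{u, w} L) {Γ : List L.Sorts}
    (φ : Formula L σ Γ) (x : ∀ i, M (σ i)) :
    ∀ ε > 0, ∃ δ > 0, ∀ y y' : ∀ j : Fin Γ.length, M (Γ.get j),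
      (∀ j, Dist.dist (y j) (y' j) < δ) → |φ.eval M x y - φ.eval M x y'| ≤ ε := by
  have hext : ∀ {Γ : List L.Sorts} {s : L.Sorts} {δ : ℝ} (_ : 0 < δ) (z : M s)
      (y y' : ∀ j : Fin Γ.length, M (Γ.get j)), (∀ j, Dist.dist (y j) (y' j) < δ) →
      ∀ j, Dist.dist (extend M z y j) (extend M z y' j) < δ := by
    intro Γ s δ hδ z y y' h j
    refine Fin.cases ?_ (fun j => ?_) j
    · change Dist.dist z z < δ
      rwa [dist_self]
    · exact h j
  induction φ with
  | pred P t =>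
    intro ε hε
    obtain ⟨η, hη, h⟩ := (L.predModulus P).exists_delta hε
    choose δ hδ hd using fun k => (t k).uniformContinuous_bound M x η hη
    obtain ⟨δ', hδ', hle⟩ := exists_pos_forall_lt hδ
    refine ⟨δ', hδ', fun y y' hy => ?_⟩
    refine le_trans (NNReal.coe_le_coe.2 (M.pred_modulus P _ _)) (h _ fun k => ?_).le
    exact hd k y y' fun j => (hy j).trans (hle k)
  | dist t₁ t₂ =>
    intro ε hε
    obtain ⟨δ₁, h₁, hd₁⟩ := t₁.uniformContinuous_bound M x (ε / 2) (half_pos hε)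
    obtain ⟨δ₂, h₂, hd₂⟩ := t₂.uniformContinuous_bound M x (ε / 2) (half_pos hε)
    refine ⟨min δ₁ δ₂, lt_min h₁ h₂, fun y y' hy => ?_⟩
    have := dist_dist_dist_le (t₁.eval M x y) (t₂.eval M x y) (t₁.eval M x y') (t₂.eval M x y')
    have e₁ := hd₁ y y' fun j => (hy j).trans_le (min_le_left _ _)
    have e₂ := hd₂ y y' fun j => (hy j).trans_le (min_le_right _ _)
    rw [Real.dist_eq] at this
    simp only [Formula.eval]
    linarith
  | const r => exact fun ε hε => ⟨1, one_pos, fun y y' _ => by simpa [Formula.eval] using hε.le⟩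
  | add φ ψ ihφ ihψ =>
    intro ε hε
    obtain ⟨δ₁, h₁, hd₁⟩ := ihφ (ε / 2) (half_pos hε)
    obtain ⟨δ₂, h₂, hd₂⟩ := ihψ (ε / 2) (half_pos hε)
    refine ⟨min δ₁ δ₂, lt_min h₁ h₂, fun y y' hy => ?_⟩
    have e₁ := hd₁ y y' fun j => (hy j).trans_le (min_le_left _ _)
    have e₂ := hd₂ y y' fun j => (hy j).trans_le (min_le_right _ _)
    simp only [Formula.eval]
    rw [add_sub_add_comm]
    exact (abs_add_le _ _).trans (by linarith)
  | smul r φ ih =>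
    intro ε hε
    obtain ⟨δ, hδ, hd⟩ := ih (ε / (|r| + 1)) (by positivity)
    refine ⟨δ, hδ, fun y y' hy => ?_⟩
    simp only [Formula.eval]
    rw [← mul_sub, abs_mul]
    have h := hd y y' hy
    rw [le_div_iff₀ (by positivity)] at h
    nlinarith [abs_nonneg (φ.eval M x y - φ.eval M x y'), abs_nonneg r]
  | sup s φ ih =>
    intro ε hε
    obtain ⟨δ, hδ, hd⟩ := ih ε hε
    exact ⟨δ, hδ, fun y y' hy => abs_ciSup_sub_ciSup_le (φ.bddAbove_eval M x y)
      (φ.bddAbove_eval M x y') fun z => hd _ _ (hext hδ z y y' hy)⟩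
  | inf s φ ih =>
    intro ε hε
    obtain ⟨δ, hδ, hd⟩ := ih ε hε
    refine ⟨δ, hδ, fun y y' hy => ?_⟩
    simp only [Formula.eval]
    rw [iInf_eq_neg_iSup_neg, iInf_eq_neg_iSup_neg, ← neg_sub', abs_neg]
    refine abs_ciSup_sub_ciSup_le ?_ ?_ fun z => ?_
    · exact (φ.smul (-1)).bddAbove_eval M x y |>.mono (by simp [Formula.eval])
    · exact (φ.smul (-1)).bddAbove_eval M x y' |>.mono (by simp [Formula.eval])
    · rw [← neg_sub', abs_neg]
      exact hd _ _ (hext hδ z y y' hy)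

theorem Formula.continuous_eval_extend (M : Structure.{u, w} L) {Γ : List L.Sorts} {s : L.Sorts}
    (φ : Formula L σ (s :: Γ)) (x : ∀ i, M (σ i)) (y : ∀ j : Fin Γ.length, M (Γ.get j)) :
    Continuous fun z => φ.eval M x (extend M z y) := by
  refine Metric.continuous_iff.2 fun z ε hε => ?_
  obtain ⟨δ, hδ, hd⟩ := φ.uniformContinuous_bound M x (ε / 2) (half_pos hε)
  refine ⟨δ, hδ, fun z' hz => lt_of_le_of_lt (hd _ _ fun j => ?_) (half_lt_self hε)⟩
  refine Fin.cases ?_ (fun j => ?_) j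
  · exact hz
  · change Dist.dist (y j) (y j) < δ
    rwa [dist_self]

end Continuity

/-! ### Ultrameans and Łoś's theorem. -/

section Ultramean

open UniformSpace

variable {L : Signature.{u}} {Y : Type v}

/-- The families of elements of a sort, as a pseudometric space with the mean distance. -/
def MeanPower (M : Structure.{u, w} L) (_ : Mean Y) (s : L.Sorts) : Type max v w := Y → M s

variable (M : Structure.{u, w} L) (Λ : Mean Y)

theorem Structure.abs_dist_le {s : L.Sorts} (x y : M s) : |dist x y| ≤ L.diam s := by
  rw [abs_of_nonneg dist_nonneg]
  exact M.dist_le x y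

noncomputable instance (s : L.Sorts) : PseudoMetricSpace (MeanPower M Λ s) where
  dist x y := Λ fun i => dist (x i) (y i)
  dist_self x := by simpa using Λ.map_const 0
  dist_comm x y := by simp only [dist_comm]
  dist_triangle x y z := by
    rw [← Λ.map_add]
    refine Λ.mono (C := L.diam s) (D := L.diam s + L.diam s) (fun i => M.abs_dist_le _ _)
      (fun i => (abs_add_le _ _).trans (add_le_add (M.abs_dist_le _ _) (M.abs_dist_le _ _)))
      fun i => dist_triangle _ _ _

theorem MeanPower.dist_eq {s : L.Sorts} (x y : MeanPower M Λ s) :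
    dist x y = Λ fun i => dist (x i) (y i) := rfl

/-- A family of elements of a sort as an element of the completion of the space of families. -/
noncomputable def MeanPower.of {s : L.Sorts} (x : Y → M s) : Completion (MeanPower M Λ s) :=
  Completion.coe' (α := MeanPower M Λ s) x

theorem MeanPower.nndist_of {s : L.Sorts} (x y : MeanPower M Λ s) :
    nndist (MeanPower.of M Λ x) (MeanPower.of M Λ y) = nndist x y :=
  Completion.coe_isometry.nndist_eq _ _

/-- Jensen's inequality, with mean distances as the averaged arguments. Through it concavity of the
moduli makes the ultramean respect the moduli of the signature. -/
theorem MeanPower.nndist_le_modulus {n : ℕ} (Δ : Modulus n) {τ : Fin n → L.Sorts}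
    (x y : ∀ k, MeanPower M Λ (τ k)) (g : Y → ℝ) {D : ℝ} (hg : ∀ i, |g i| ≤ D)
    (h : ∀ i, g i ≤ Δ fun k => nndist (x k i) (y k i)) :
    Λ g ≤ Δ fun k => nndist (x k) (y k) := by
  refine (Λ.le_modulus Δ (fun i k => nndist (x k i) (y k i)) g
    (C := ∑ k, (L.diam (τ k) : ℝ)) (fun i k => ?_) hg h).trans (le_of_eq ?_)
  · exact (M.dist_le _ _).trans (Finset.single_le_sum (f := fun k => (L.diam (τ k) : ℝ))
      (fun k _ => (L.diam (τ k)).2) (Finset.mem_univ k))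
  · congr 2
    funext k
    exact Real.toNNReal_of_nonneg (dist_nonneg (x := x k) (y := y k))

theorem Structure.abs_pred_le (P : L.Pred) (x : ∀ k, M (L.predDom P k)) :
    |M.pred P x| ≤ max |L.predLower P| |L.predUpper P| :=
  abs_le_max_abs_abs (M.pred_mem P x).1 (M.pred_mem P x).2

theorem exists_ultramean_func (f : L.Func) :
    ∃ G : (∀ k, Completion (MeanPower M Λ (L.funcDom f k))) →
        Completion (MeanPower M Λ (L.funcCod f)), Continuous G ∧
      (∀ x : ∀ k, MeanPower M Λ (L.funcDom f k), G (fun k => MeanPower.of M Λ (x k)) =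
        MeanPower.of M Λ fun i => M.func f fun k => x k i) ∧
      ∀ x y, nndist (G x) (G y) ≤ L.funcModulus f fun k => nndist (x k) (y k) := by
  refine exists_extension_completion (L.funcModulus f) (fun x : ∀ k, MeanPower M Λ (L.funcDom f k) =>
    MeanPower.of M Λ fun i => M.func f fun k => x k i) fun x y => ?_
  exact (MeanPower.nndist_of M Λ _ _).trans_le (NNReal.coe_le_coe.1
    (MeanPower.nndist_le_modulus M Λ _ x y _ (fun i => M.abs_dist_le _ _)
      fun i => NNReal.coe_le_coe.2 (M.func_modulus f _ _)))

theorem exists_ultramean_pred (P : L.Pred) :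
    ∃ G : (∀ k, Completion (MeanPower M Λ (L.predDom P k))) → ℝ, Continuous G ∧
      (∀ x : ∀ k, MeanPower M Λ (L.predDom P k), G (fun k => MeanPower.of M Λ (x k)) =
        Λ fun i => M.pred P fun k => x k i) ∧
      ∀ x y, nndist (G x) (G y) ≤ L.predModulus P fun k => nndist (x k) (y k) := by
  refine exists_extension_completion (L.predModulus P) (fun x : ∀ k, MeanPower M Λ (L.predDom P k) =>
    Λ fun i => M.pred P fun k => x k i) fun x y => ?_
  have key : ∀ x y : ∀ k, MeanPower M Λ (L.predDom P k),
      (Λ fun i => M.pred P fun k => x k i) - (Λ fun i => M.pred P fun k => y k i) ≤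
        L.predModulus P fun k => nndist (x k) (y k) := by
    intro x y
    rw [← Λ.map_sub]
    refine MeanPower.nndist_le_modulus M Λ _ x y _
      (D := max |L.predLower P| |L.predUpper P| + max |L.predLower P| |L.predUpper P|)
      (fun i => (abs_sub _ _).trans (add_le_add (M.abs_pred_le P _) (M.abs_pred_le P _)))
      fun i => (le_abs_self _).trans (NNReal.coe_le_coe.2 (M.pred_modulus P _ _))
  rw [← NNReal.coe_le_coe, coe_nndist, Real.dist_eq]
  refine abs_sub_le_iff.2 ⟨key x y, ?_⟩
  simpa only [nndist_comm] using key y x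

/-- The ultramean of a structure with respect to a mean: the completion of the space of all
families. -/
noncomputable def ultramean : Structure.{u, max v w} L where
  carrier s := Completion (MeanPower M Λ s)
  metric s := inferInstance
  complete s := inferInstance
  nonempty s := ⟨MeanPower.of M Λ fun _ => Classical.arbitrary (M s)⟩
  nndist_le s x y := by
    refine Completion.induction_on₂ x y (isClosed_le continuous_nndist continuous_const)
      fun x y => ?_
    rw [Completion.coe_isometry.nndist_eq, ← NNReal.coe_le_coe, coe_nndist, MeanPower.dist_eq]
    exact Λ.le_of_le (fun i => M.abs_dist_le _ _) fun i => M.dist_le _ _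
  func f := (exists_ultramean_func M Λ f).choose
  func_modulus f := (exists_ultramean_func M Λ f).choose_spec.2.2
  pred P := (exists_ultramean_pred M Λ P).choose
  pred_mem P x := by
    obtain ⟨hc, he, -⟩ := (exists_ultramean_pred M Λ P).choose_spec
    have hd : DenseRange (Pi.map fun k (x : MeanPower M Λ (L.predDom P k)) =>
      (x : Completion (MeanPower M Λ (L.predDom P k)))) :=
        DenseRange.piMap fun k => Completion.denseRange_coe
    refine isClosed_property hd (isClosed_Icc.preimage hc) (fun x => ?_) x
    refine (he x).symm ▸ ⟨Λ.le_of_ge (fun i => M.abs_pred_le P _) fun i => (M.pred_mem P _).1,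
      Λ.le_of_le (fun i => M.abs_pred_le P _) fun i => (M.pred_mem P _).2⟩
  pred_modulus P := (exists_ultramean_pred M Λ P).choose_spec.2.2

/-- The element of the ultramean represented by a family. -/
noncomputable def ultramean.mk {s : L.Sorts} (x : Y → M s) : ultramean M Λ s :=
  MeanPower.of M Λ x

theorem ultramean.denseRange_mk (s : L.Sorts) : DenseRange (ultramean.mk M Λ (s := s)) :=
  Completion.denseRange_coe (α := MeanPower M Λ s)

theorem ultramean.dist_mk {s : L.Sorts} (x y : Y → M s) :
    dist (ultramean.mk M Λ x) (ultramean.mk M Λ y) = Λ fun i => dist (x i) (y i) :=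
  Completion.dist_eq _ _

theorem ultramean.func_mk (f : L.Func) (x : ∀ k, Y → M (L.funcDom f k)) :
    (ultramean M Λ).func f (fun k => ultramean.mk M Λ (x k)) =
      ultramean.mk M Λ fun i => M.func f fun k => x k i :=
  (exists_ultramean_func M Λ f).choose_spec.2.1 x

theorem ultramean.pred_mk (P : L.Pred) (x : ∀ k, Y → M (L.predDom P k)) :
    (ultramean M Λ).pred P (fun k => ultramean.mk M Λ (x k)) =
      Λ fun i => M.pred P fun k => x k i :=
  (exists_ultramean_pred M Λ P).choose_spec.2.1 x

/-- The supremum of a continuous function on the ultramean that is given by means on families. -/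
theorem ultramean.iSup_eq {s : L.Sorts} (Φ : ultramean M Λ s → ℝ) (hΦ : Continuous Φ)
    (φ : Y → M s → ℝ) {C : ℝ} (hφ : ∀ i z, |φ i z| ≤ C)
    (h : ∀ z : Y → M s, Φ (ultramean.mk M Λ z) = Λ fun i => φ i (z i)) :
    ⨆ z, Φ z = Λ fun i => ⨆ z, φ i z := by
  have hbdd : ∀ i, BddAbove (Set.range (φ i)) := fun i =>
    ⟨C, by rintro _ ⟨z, rfl⟩; exact (abs_le.1 (hφ i z)).2⟩
  have hsup : ∀ i, |⨆ z, φ i z| ≤ C := fun i => abs_le.2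
    ⟨(abs_le.1 (hφ i (Classical.arbitrary _))).1.trans (le_ciSup (hbdd i) _),
      ciSup_le fun z => (abs_le.1 (hφ i z)).2⟩
  have hle : ∀ z, Φ z ≤ Λ fun i => ⨆ z, φ i z := by
    refine isClosed_property (ultramean.denseRange_mk M Λ s) (isClosed_le hΦ continuous_const)
      fun z => ?_
    rw [h]
    exact Λ.mono (fun i => hφ i _) hsup fun i => le_ciSup (hbdd i) _
  refine le_antisymm (ciSup_le hle) (le_of_forall_pos_le_add fun ε hε => ?_)
  -- Near-optimal witnesses chosen index by index form one element of the ultramean. No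
  -- measurability is at stake, since the mean is defined on all bounded functions.
  choose z hz using fun i => exists_lt_of_lt_ciSup (sub_lt_self (⨆ z, φ i z) hε)
  have h₁ : Φ (ultramean.mk M Λ z) ≤ ⨆ z, Φ z :=
    le_ciSup ⟨_, by rintro _ ⟨z, rfl⟩; exact hle z⟩ _
  have h₂ : (Λ fun i => ⨆ z, φ i z) ≤ Λ fun i => φ i (z i) + ε :=
    Λ.mono hsup (D := C + |ε|) (fun i => (abs_add_le _ _).trans (by linarith [hφ i (z i)]))
      fun i => by linarith [hz i]
  rw [Λ.map_add, Λ.map_const, ← h] at h₂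
  linarith

/-- The extension of a family of assignments of the bound variables by a family of new values. -/
def extendFamily {Γ : List L.Sorts} {s : L.Sorts} (z : Y → M s)
    (y : ∀ j : Fin Γ.length, Y → M (Γ.get j)) :
    ∀ j : Fin (s :: Γ).length, Y → M ((s :: Γ).get j) :=
  Fin.cons (α := fun j : Fin (Γ.length + 1) => Y → M ((s :: Γ).get j)) z y

theorem extendFamily_apply {Γ : List L.Sorts} {s : L.Sorts} (z : Y → M s)
    (y : ∀ j : Fin Γ.length, Y → M (Γ.get j)) (i : Y) :
    (fun j => extendFamily M z y j i) = extend M (z i) fun j => y j i := by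
  funext j
  refine Fin.cases rfl (fun j => rfl) j

theorem ultramean.mk_extendFamily {Γ : List L.Sorts} {s : L.Sorts} (z : Y → M s)
    (y : ∀ j : Fin Γ.length, Y → M (Γ.get j)) :
    (fun j => ultramean.mk M Λ (extendFamily M z y j)) =
        extend (ultramean M Λ) (ultramean.mk M Λ z) fun j => ultramean.mk M Λ (y j) := by
  funext j
  refine Fin.cases rfl (fun j => rfl) j

variable {V : Type*} {σ : V → L.Sorts}

theorem ultramean.eval_term {Γ : List L.Sorts} {s : L.Sorts} (t : Term L σ Γ s)
    (x : ∀ i, Y → M (σ i)) (y : ∀ j : Fin Γ.length, Y → M (Γ.get j)) :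
    t.eval (ultramean M Λ) (fun i => ultramean.mk M Λ (x i)) (fun j => ultramean.mk M Λ (y j)) =
      ultramean.mk M Λ fun i => t.eval M (fun k => x k i) fun j => y j i := by
  induction t with
  | free i => rfl
  | bound j => rfl
  | app f t ih => simp only [Term.eval, ih, ultramean.func_mk]

/-- Łoś's theorem for ultrameans: the value of an affine formula in the ultramean is the mean of its
values. -/
theorem ultramean.eval_formula {Γ : List L.Sorts} (φ : Formula L σ Γ)
    (x : ∀ i, Y → M (σ i)) (y : ∀ j : Fin Γ.length, Y → M (Γ.get j)) :
    φ.eval (ultramean M Λ) (fun i => ultramean.mk M Λ (x i)) (fun j => ultramean.mk M Λ (y j)) =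
      Λ fun i => φ.eval M (fun k => x k i) fun j => y j i := by
  induction φ with
  | pred P t => simp only [Formula.eval, ultramean.eval_term, ultramean.pred_mk]
  | dist t₁ t₂ => simp only [Formula.eval, ultramean.eval_term, ultramean.dist_mk]
  | const r => exact (Λ.map_const r).symm
  | add φ ψ ihφ ihψ => simp only [Formula.eval, ihφ, ihψ, Λ.map_add]
  | smul r φ ih => simp only [Formula.eval, ih, Λ.map_mul]
  | sup s φ ih =>
    obtain ⟨C, hC⟩ := φ.exists_abs_eval_le M
    refine ultramean.iSup_eq M Λ _ (φ.continuous_eval_extend _ _ _)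
      (fun i z => φ.eval M (fun k => x k i) (extend M z fun j => y j i)) (fun i z => hC _ _)
      fun z => ?_
    rw [← ultramean.mk_extendFamily, ih]
    simp only [extendFamily_apply]
  | inf s φ ih =>
    obtain ⟨C, hC⟩ := φ.exists_abs_eval_le M
    simp only [Formula.eval, iInf_eq_neg_iSup_neg, Λ.map_neg]
    congr 1
    refine ultramean.iSup_eq M Λ _ (φ.continuous_eval_extend _ _ _).neg
      (fun i z => -φ.eval M (fun k => x k i) (extend M z fun j => y j i))
      (fun i z => (abs_neg _).trans_le (hC _ _)) fun z => ?_
    rw [Λ.map_neg, Pi.neg_apply, ← ultramean.mk_extendFamily, ih]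
    simp only [extendFamily_apply]

theorem ultramean.value (φ : Formula L σ []) (x : ∀ i, Y → M (σ i)) :
    φ.value (ultramean M Λ) (fun i => ultramean.mk M Λ (x i)) =
      Λ fun i => φ.value M fun k => x k i := by
  have h := ultramean.eval_formula M Λ φ x fun j => j.elim0
  refine Eq.trans ?_ (h.trans ?_)
  · rw [Formula.value]
    congr 1
    exact funext fun j => j.elim0
  · congr 1
    funext i
    rw [Formula.value]
    congr 1
    exact funext fun j => j.elim0

/-- The diagonal embedding of a structure in its ultramean. -/
noncomputable def ultramean.diag : AffineEmbedding M (ultramean M Λ) where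
  toFun _ m := ultramean.mk M Λ fun _ => m
  value_eq _ φ x := (ultramean.value M Λ φ fun i _ => x i).trans (Λ.map_const _)

end Ultramean

/-! ### Functions affine over `A`, and the telescoping inequality. -/

section DefinableOver

universe v' v''

variable {L : Signature.{u}} {M : Structure.{u, w} L} {A : ∀ s, Set (M s)}
variable {I : Type v} {σ : I → L.Sorts} {K : Type v'} {τ : K → L.Sorts}

variable (M A σ) in
/-- The real functions of a tuple of elements that are given by affine formulas with parameters in
`A`. -/
def DefinableOver (f : (∀ i, M (σ i)) → ℝ) : Prop :=
  ∃ φ : Formula L (paramSort M A σ) [], ∀ x, φ.value M (withParams M A x) = f x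

namespace DefinableOver

theorem add {f g : (∀ i, M (σ i)) → ℝ} (hf : DefinableOver M A σ f)
    (hg : DefinableOver M A σ g) : DefinableOver M A σ fun x => f x + g x := by
  obtain ⟨φ, hφ⟩ := hf
  obtain ⟨ψ, hψ⟩ := hg
  exact ⟨.add φ ψ, fun x => congrArg₂ (· + ·) (hφ x) (hψ x)⟩

theorem mul {f : (∀ i, M (σ i)) → ℝ} (r : ℝ) (hf : DefinableOver M A σ f) :
    DefinableOver M A σ fun x => r * f x := by
  obtain ⟨φ, hφ⟩ := hf
  exact ⟨.smul r φ, fun x => congrArg (r * ·) (hφ x)⟩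

theorem sub {f g : (∀ i, M (σ i)) → ℝ} (hf : DefinableOver M A σ f)
    (hg : DefinableOver M A σ g) : DefinableOver M A σ fun x => f x - g x := by
  convert hf.add (hg.mul (-1)) using 2
  ring

theorem const (r : ℝ) : DefinableOver M A σ fun _ => r :=
  ⟨.const r, fun _ => rfl⟩

theorem exists_abs_le {f : (∀ i, M (σ i)) → ℝ} (hf : DefinableOver M A σ f) :
    ∃ C, ∀ x, |f x| ≤ C := by
  obtain ⟨φ, hφ⟩ := hf
  obtain ⟨C, hC⟩ := φ.exists_abs_eval_le M
  exact ⟨C, fun x => hφ x ▸ hC _ _⟩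

/-- Definable functions are stable under substitution of terms. -/
theorem comp {f : (∀ k, M (τ k)) → ℝ} (hf : DefinableOver M A τ f)
    (r : (∀ i, M (σ i)) → ∀ k, M (τ k))
    (hr : ∀ k, ∃ t : Term L (paramSort M A σ) [] (τ k),
      ∀ x, t.eval M (withParams M A x) (fun j : Fin 0 => j.elim0) = r x k) :
    DefinableOver M A σ fun x => f (r x) := by
  obtain ⟨φ, hφ⟩ := hf
  choose t ht using hr
  refine ⟨φ.substFree fun k => match k with
    | .inl k => t k
    | .inr p => .free (σ := paramSort M A σ) (.inr p), fun x => ?_⟩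
  rw [Formula.value_substFree]
  refine Eq.trans ?_ (hφ (r x))
  congr 1
  funext k
  rcases k with k | p
  · exact ht k x
  · rfl

theorem exists_isGLB {f : (∀ i, M (Sum.elim σ τ i)) → ℝ}
    (hf : DefinableOver M A (Sum.elim σ τ) f) :
    ∃ g, DefinableOver M A σ g ∧
      ∀ x, IsGLB (Set.range fun y : ∀ k, M (τ k) => f (pair x y)) (g x) := by
  obtain ⟨φ, hφ⟩ := hf
  obtain ⟨ψ, hψ⟩ := Formula.exists_isGLB.{u, max u v w, w, v'} (σ := paramSort M A σ) (τ := τ)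
    (φ.substFree fun k => match k with
      | .inl (.inl i) => .free (σ := Sum.elim (paramSort M A σ) τ) (.inl (.inl i))
      | .inl (.inr k) => .free (σ := Sum.elim (paramSort M A σ) τ) (.inr k)
      | .inr p => .free (σ := Sum.elim (paramSort M A σ) τ) (.inl (.inr p)))
  refine ⟨fun x => ψ.value M (withParams M A x), ⟨ψ, fun x => rfl⟩, fun x => ?_⟩
  convert hψ M (withParams M A x) using 3
  rename_i y
  rw [Formula.value_substFree, ← hφ]
  congr 1
  funext k
  rcases k with (i | k) | p <;> rfl

theorem exists_isLUB {f : (∀ i, M (Sum.elim σ τ i)) → ℝ}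
    (hf : DefinableOver M A (Sum.elim σ τ) f) :
    ∃ g, DefinableOver M A σ g ∧
      ∀ x, IsLUB (Set.range fun y : ∀ k, M (τ k) => f (pair x y)) (g x) := by
  obtain ⟨g, hg, h⟩ := (hf.mul (-1)).exists_isGLB
  refine ⟨_, hg.mul (-1), fun x => ⟨?_, fun r hr => ?_⟩⟩
  · rintro _ ⟨y, rfl⟩
    have := (h x).1 ⟨y, rfl⟩
    simp only at this ⊢
    linarith
  · have : -r ≤ g x := (h x).2 (by
      rintro _ ⟨y, rfl⟩
      have := hr ⟨y, rfl⟩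
      simp only at this ⊢
      linarith)
    linarith

end DefinableOver

theorem TypeEqOver.eq {a b : ∀ i, M (σ i)} (hab : TypeEqOver M A a b) {f : (∀ i, M (σ i)) → ℝ}
    (hf : DefinableOver M A σ f) : f a = f b := by
  obtain ⟨φ, hφ⟩ := hf
  rw [← hφ, ← hφ, hab φ]

/-- Passes from the presentation of parameters as a second tuple, used in
`TypeEqOver.exists_realization`, to the one by `paramSort`. -/
theorem Formula.definableOver (ψ : Formula L (Sum.elim σ fun p : Σ s, A s => p.1) []) :
    DefinableOver M A σ fun x => ψ.value M (pair x fun p => p.2.1) := by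
  refine ⟨ψ.substFree fun k => match k with
    | .inl i => .free (σ := paramSort M A σ) (.inl i)
    | .inr p => .free (σ := paramSort M A σ) (.inr p), fun x => ?_⟩
  rw [Formula.value_substFree]
  congr 1
  funext k
  rcases k with i | p <;> rfl

theorem Formula.definableOver_of_free (φ : Formula L σ []) :
    DefinableOver M A σ fun x => φ.value M x :=
  ⟨φ.substFree fun i => .free (σ := paramSort M A σ) (.inl i),
    fun _ => φ.value_substFree M _ _⟩

/-- If `a` and `b` have the same affine type over `A`, then every value over `A` is dominated by the
supremum of its perturbations by differences between `a` and `b`. -/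
theorem TypeEqOver.le_of_forall_le {a b : ∀ i, M (σ i)} (hab : TypeEqOver M A a b)
    {ψ : (∀ k, M (τ k)) → ℝ} (hψ : DefinableOver M A τ ψ)
    {φ : (∀ i, M (Sum.elim σ τ i)) → ℝ} (hφ : DefinableOver M A (Sum.elim σ τ) φ)
    (e : ∀ k, M (τ k)) {C : ℝ} (h : ∀ y, ψ y + φ (pair a y) - φ (pair b y) ≤ C) : ψ e ≤ C := by
  -- The three summands of ψ(y) + φ(x, y) − φ(x', y), as functions of the joint tuple ((x, x'), y).
  have h₀ : DefinableOver M A (Sum.elim (Sum.elim σ σ) τ) fun z => ψ fun k => z (.inr k) :=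
    hψ.comp (fun z k => z (.inr k)) fun k =>
      ⟨.free (σ := paramSort M A (Sum.elim (Sum.elim σ σ) τ)) (.inl (.inr k)), fun _ => rfl⟩
  have h₁ : DefinableOver M A (Sum.elim (Sum.elim σ σ) τ) fun z =>
      φ (pair (fun i => z (.inl (.inl i))) fun k => z (.inr k)) :=
    hφ.comp _ fun k => match k with
      | .inl i => ⟨.free (σ := paramSort M A (Sum.elim (Sum.elim σ σ) τ)) (.inl (.inl (.inl i))),
          fun _ => rfl⟩
      | .inr k => ⟨.free (σ := paramSort M A (Sum.elim (Sum.elim σ σ) τ)) (.inl (.inr k)),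
          fun _ => rfl⟩
  have h₂ : DefinableOver M A (Sum.elim (Sum.elim σ σ) τ) fun z =>
      φ (pair (fun i => z (.inl (.inr i))) fun k => z (.inr k)) :=
    hφ.comp _ fun k => match k with
      | .inl i => ⟨.free (σ := paramSort M A (Sum.elim (Sum.elim σ σ) τ)) (.inl (.inl (.inr i))),
          fun _ => rfl⟩
      | .inr k => ⟨.free (σ := paramSort M A (Sum.elim (Sum.elim σ σ) τ)) (.inl (.inr k)),
          fun _ => rfl⟩
  obtain ⟨χ, hχ, hlub⟩ := ((h₀.add h₁).sub h₂).exists_isLUB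
  have hle : ∀ x x' y, ψ y + φ (pair x y) - φ (pair x' y) ≤ χ (pair x x') := fun x x' y =>
    (hlub (pair x x')).1 ⟨y, rfl⟩
  have hC : χ (pair a b) ≤ C := (hlub (pair a b)).2 (by rintro _ ⟨y, rfl⟩; exact h y)
  -- `F x` is the infimum of the total χ-cost of chains of `n` steps from `x`. The last clause is
  -- the telescoped sum along a nearly optimal chain, of which only the endpoint `x'` is kept.
  have key : ∀ n : ℕ, ∃ F, DefinableOver M A σ F ∧ F a ≤ n * χ (pair a b) ∧
      ∀ x, ∀ ε > 0, ∃ x', ∀ y, n * ψ y + φ (pair x y) - φ (pair x' y) ≤ F x + ε := by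
    intro n
    induction n with
    | zero =>
      refine ⟨_, .const 0, by simp, fun x ε hε => ⟨x, fun y => ?_⟩⟩
      simpa using hε.le
    | succ n ih =>
      obtain ⟨F, hF, hFa, hx⟩ := ih
      have h₃ : DefinableOver M A (Sum.elim σ σ) fun z => F fun i => z (.inr i) :=
        hF.comp _ fun i =>
          ⟨.free (σ := paramSort M A (Sum.elim σ σ)) (.inl (.inr i)), fun _ => rfl⟩
      obtain ⟨G, hG, hglb⟩ := (hχ.add h₃).exists_isGLB
      refine ⟨G, hG, ?_, fun x ε hε => ?_⟩
      · have h₄ : G a ≤ χ (pair a b) + F b := (hglb a).1 ⟨b, rfl⟩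
        -- The only use of the equality of types: `F` is affine over `A`, so a chain from `b` costs
        -- no more than one from `a`.
        rw [← hab.eq hF] at h₄
        push_cast
        linarith
      -- The infimum need not be attained: half of ε pays for the first step, the other half for the
      -- rest of the chain.
      · obtain ⟨_, ⟨x', rfl⟩, -, hx'⟩ := (hglb x).exists_between (lt_add_of_pos_right (G x)
          (half_pos hε))
        obtain ⟨x'', hx''⟩ := hx x' (ε / 2) (half_pos hε)
        refine ⟨x'', fun y => ?_⟩
        have h₅ : χ (pair x x') + F x' < G x + ε / 2 := hx'
        have := hx'' y
        have := hle x x' y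
        push_cast
        linarith
  obtain ⟨D, hD⟩ := hφ.exists_abs_le
  -- The 1 is the error allowed along the chain, and 2D bounds the two endpoint terms left by
  -- telescoping. The bound is independent of `n`, which forces ψ(e) ≤ C.
  have hn : ∀ n : ℕ, n * (ψ e - C) ≤ 1 + 2 * D := by
    intro n
    obtain ⟨F, -, hFa, hx⟩ := key n
    obtain ⟨x', hx'⟩ := hx a 1 one_pos
    have h₆ := hx' e
    have h₇ := abs_le.1 (hD (pair a e))
    have h₈ := abs_le.1 (hD (pair x' e))
    have h₉ : n * χ (pair a b) ≤ n * C := mul_le_mul_of_nonneg_left hC n.cast_nonneg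
    linarith
  by_contra hlt
  obtain ⟨n, hn'⟩ := exists_nat_gt ((1 + 2 * D) / (ψ e - C))
  rw [div_lt_iff₀ (sub_pos.2 (not_le.1 hlt))] at hn'
  exact (hn n).not_gt hn'

end DefinableOver

/-! ### Realizing the copy, and the two conclusions. -/

section Realization

universe v'

variable {L : Signature.{u}} {M : Structure.{u, w} L} {A : ∀ s, Set (M s)}
variable {I : Type v} {σ : I → L.Sorts} {K : Type (max u w)} {τ : K → L.Sorts}

/-- If `a` and `b` have the same affine type over `A`, then in some affine extension a realization
`e'` of the affine type of `e` over `A` is such that `a` and `b` have the same affine type over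
`e'`. -/
theorem TypeEqOver.exists_realization {a b : ∀ i, M (σ i)} (hab : TypeEqOver M A a b)
    (e : ∀ k, M (τ k)) :
    ∃ (N : Structure.{u, max u w} L) (j : AffineEmbedding M N) (e' : ∀ k, N (τ k)),
      (∀ (V : Type (max u w)) (υ : V → L.Sorts) (x : ∀ i, M (υ i)) (φ : Formula L υ []),
        φ.value N (j.tuple x) = φ.value M x) ∧
      (∀ ψ : Formula L (Sum.elim τ fun p : Σ s, A s => p.1) [],
        ψ.value N (pair e' fun p => j.toFun p.1 p.2.1) =
          ψ.value M (pair e fun p : Σ s, A s => p.2.1)) ∧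
      ∀ φ : Formula L (Sum.elim σ τ) [],
        φ.value N (pair (j.tuple a) e') = φ.value N (pair (j.tuple b) e') := by
  let Y : Type (max u w) := ∀ k, M (τ k)
  -- Annihilating the ψ-part gives the generic tuple the type of `e` over `A`; annihilating the
  -- φ-part makes `a` and `b` indistinguishable over it.
  let W : Submodule ℝ (Y → ℝ) :=
    { carrier := {f | ∃ ψ φ, DefinableOver M A τ ψ ∧ DefinableOver M A (Sum.elim σ τ) φ ∧
        ∀ y, f y = ψ y - ψ e + (φ (pair a y) - φ (pair b y))}
      zero_mem' := ⟨_, _, .const 0, .const 0, fun y => by simp⟩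
      add_mem' := by
        rintro f g ⟨ψ, φ, hψ, hφ, hf⟩ ⟨ψ', φ', hψ', hφ', hg⟩
        refine ⟨_, _, hψ.add hψ', hφ.add hφ', fun y => ?_⟩
        rw [Pi.add_apply, hf, hg]
        ring
      smul_mem' := by
        rintro r f ⟨ψ, φ, hψ, hφ, hf⟩
        refine ⟨_, _, hψ.mul r, hφ.mul r, fun y => ?_⟩
        rw [Pi.smul_apply, hf, smul_eq_mul]
        ring }
  have : Nonempty Y := ⟨e⟩
  obtain ⟨Λ, hΛ⟩ := Mean.exists_eq_zero W (by
    rintro f ⟨ψ, φ, hψ, hφ, hf⟩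
    obtain ⟨C, hC⟩ := hψ.exists_abs_le
    obtain ⟨D, hD⟩ := hφ.exists_abs_le
    refine ⟨C + C + (D + D), fun y => ?_⟩
    rw [hf]
    exact (abs_add_le _ _).trans (add_le_add ((abs_sub _ _).trans (add_le_add (hC _) (hC _)))
      ((abs_sub _ _).trans (add_le_add (hD _) (hD _))))) (by
    rintro f ⟨ψ, φ, hψ, hφ, hf⟩ C hC
    have := hab.le_of_forall_le hψ hφ e (C := C + ψ e) fun y => by
      have := hC y
      rw [hf] at this
      linarith
    linarith)
  -- The realization is the identity family on `Y`, read coordinate by coordinate.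
  refine ⟨ultramean M Λ, ultramean.diag M Λ, fun k => ultramean.mk M Λ fun y => y k,
    fun V υ x φ => ?_, fun ψ => ?_, fun φ => ?_⟩
  · exact (ultramean.value M Λ φ fun i _ => x i).trans (Λ.map_const _)
  · have h := ultramean.value M Λ ψ fun i => match i with
      | .inl k => fun y : Y => y k
      | .inr p => fun _ => p.2.1
    have hg := hΛ (fun y => ψ.value M (pair y fun p => p.2.1) - ψ.value M (pair e fun p => p.2.1))
      ⟨_, _, ψ.definableOver, .const 0, fun y => by simp⟩
    rw [Λ.map_sub, Λ.map_const, sub_eq_zero] at hg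
    refine Eq.trans ?_ (h.trans (Eq.trans ?_ hg))
    · congr 1
      funext i
      rcases i with k | p <;> rfl
    · congr 1
      funext y
      congr 1
      funext i
      rcases i with k | p <;> rfl
  · have h : ∀ x : ∀ i, M (σ i), φ.value (ultramean M Λ) (pair ((ultramean.diag M Λ).tuple x)
        fun k => ultramean.mk M Λ fun y => y k) = Λ fun y => φ.value M (pair x y) := by
      intro x
      have h := ultramean.value M Λ φ fun i => match i with
        | .inl i => fun _ : Y => x i
        | .inr k => fun y => y k
      refine Eq.trans ?_ (h.trans ?_)
      · congr 1
        funext i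
        rcases i with k | p <;> rfl
      · congr 1
        funext y
        congr 1
        funext i
        rcases i with k | p <;> rfl
    have hg := hΛ (fun y => φ.value M (pair a y) - φ.value M (pair b y))
      ⟨_, _, .const 0, φ.definableOver_of_free, fun y => by simp⟩
    rw [Λ.map_sub, sub_eq_zero] at hg
    rw [h, h, hg]

/-- Equality of affine types over a set all of whose elements occur in a tuple. -/
theorem TypeEqOver.of_forall_value_eq {N : Structure.{u, w} L} {B : ∀ s, Set (N s)}
    {P : L.Sorts → Type v'} (e : ∀ p : Σ s, P s, N p.1)
    (hB : ∀ s, ∀ x ∈ B s, ∃ p : P s, e ⟨s, p⟩ = x) {a b : ∀ i, N (σ i)}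
    (h : ∀ φ : Formula L (Sum.elim σ fun p : Σ s, P s => p.1) [],
      φ.value N (pair a e) = φ.value N (pair b e)) : TypeEqOver N B a b := by
  intro φ
  choose p hp using hB
  let ρ : ∀ i, Term L (Sum.elim σ fun p : Σ s, P s => p.1) [] (paramSort N B σ i) := fun i =>
    match i with
    | .inl i => .free (σ := Sum.elim σ fun p : Σ s, P s => p.1) (.inl i)
    | .inr q => .free (σ := Sum.elim σ fun p : Σ s, P s => p.1) (.inr ⟨q.1, p q.1 q.2.1 q.2.2⟩)
  have key : ∀ x : ∀ i, N (σ i),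
      (φ.substFree ρ).value N (pair x e) = φ.value N (withParams N B x) := by
    intro x
    rw [Formula.value_substFree]
    congr 1
    funext i
    rcases i with i | q
    · rfl
    · exact hp q.1 q.2.1 q.2.2
  rw [← key, ← key, h]

/-- A copy of a structure in a larger universe. -/
def Structure.ulift (M : Structure.{u, w} L) : Structure.{u, max w v'} L where
  carrier s := ULift.{v'} (M s)
  metric _ := inferInstance
  complete _ := inferInstance
  nonempty _ := inferInstance
  nndist_le _ x y := M.nndist_le _ x.down y.down
  func f x := ⟨M.func f fun k => (x k).down⟩
  func_modulus f x y := M.func_modulus f (fun k => (x k).down) fun k => (y k).down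
  pred P x := M.pred P fun k => (x k).down
  pred_mem P x := M.pred_mem P fun k => (x k).down
  pred_modulus P x y := M.pred_modulus P (fun k => (x k).down) fun k => (y k).down

theorem Term.eval_ulift {Γ : List L.Sorts} {s : L.Sorts} (t : Term L σ Γ s)
    (x : ∀ i, M.ulift (σ i)) (y : ∀ j : Fin Γ.length, M.ulift (Γ.get j)) :
    t.eval (Structure.ulift.{u, w, v'} M) x y =
      ⟨t.eval M (fun i => (x i).down) fun j => (y j).down⟩ := by
  induction t with
  | free i => rfl
  | bound j => rfl
  | app f t ih =>
    simp only [Term.eval, ih]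
    rfl

theorem down_extend {Γ : List L.Sorts} {s : L.Sorts} (z : ULift.{v'} (M s))
    (y : ∀ j : Fin Γ.length, M.ulift (Γ.get j)) :
    (fun j => (extend (Structure.ulift.{u, w, v'} M) z y j).down) =
      extend M z.down fun j => (y j).down := by
  funext j
  refine Fin.cases rfl (fun j => rfl) j

theorem Formula.eval_ulift {Γ : List L.Sorts} (φ : Formula L σ Γ)
    (x : ∀ i, M.ulift (σ i)) (y : ∀ j : Fin Γ.length, M.ulift (Γ.get j)) :
    φ.eval (Structure.ulift.{u, w, v'} M) x y =
      φ.eval M (fun i => (x i).down) fun j => (y j).down := by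
  induction φ with
  | pred P t =>
    simp only [Formula.eval, Term.eval_ulift]
    rfl
  | dist t₁ t₂ =>
    simp only [Formula.eval, Term.eval_ulift]
    rfl
  | const r => rfl
  | add φ ψ ihφ ihψ => simp only [Formula.eval, ihφ, ihψ]
  | smul r φ ih => simp only [Formula.eval, ih]
  | sup s φ ih =>
    simp only [Formula.eval, ih]
    refine Equiv.iSup_congr Equiv.ulift fun z => ?_
    exact congrArg (φ.eval M _) (down_extend z y).symm
  | inf s φ ih =>
    simp only [Formula.eval, ih]
    refine Equiv.iInf_congr Equiv.ulift fun z => ?_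
    exact congrArg (φ.eval M _) (down_extend z y).symm

/-- For tuples with the same affine type over `A` and a set `B` containing `A`, some affine
extension has a copy of `B` over `A` over which the tuples have the same affine type. -/
theorem TypeEqOver.exists_copy {a b : ∀ i, M (σ i)} (hab : TypeEqOver M A a b)
    (B : ∀ s, Set (M s)) (hAB : ∀ s, A s ⊆ B s) :
    ∃ (N : Structure.{u, max u w} L) (j : AffineEmbedding M N)
      (e : ∀ p : Σ s, B s, N p.1),
      (∀ (V : Type (max u w)) (υ : V → L.Sorts) (x : ∀ i, M (υ i)) (φ : Formula L υ []),
        φ.value N (j.tuple x) = φ.value M x) ∧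
      (∀ ψ : Formula L (Sum.elim (fun p : Σ s, B s => p.1) fun p : Σ s, A s => p.1) [],
        ψ.value N (pair e fun p => j.toFun p.1 p.2.1) =
          ψ.value M (pair (fun p : Σ s, B s => p.2.1) fun p : Σ s, A s => p.2.1)) ∧
      (∀ s (x : M s) (hx : x ∈ A s), e ⟨s, x, hAB s hx⟩ = j.toFun s x) ∧
      ∀ B' : ∀ s, Set (N s), (∀ s, ∀ x ∈ B' s, ∃ p : B s, e ⟨s, p⟩ = x) →
        TypeEqOver N B' (j.tuple a) (j.tuple b) := by
  obtain ⟨N, j, e, h₁, h₂, h₃⟩ := hab.exists_realization (τ := fun p : Σ s, B s => p.1)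
    fun p => p.2.1
  refine ⟨N, j, e, h₁, h₂, fun s x hx => ?_, fun B' hB' => .of_forall_value_eq e hB' h₃⟩
  -- The distance from an element of `A` to itself is part of the type of the copy over `A`; it
  -- vanishes, so the copy fixes `A` pointwise.
  have h := h₂ (.dist
    (.free (σ := Sum.elim (fun p : Σ s, B s => p.1) fun p : Σ s, A s => p.1)
      (.inl ⟨s, x, hAB s hx⟩))
    (.free (σ := Sum.elim (fun p : Σ s, B s => p.1) fun p : Σ s, A s => p.1)
      (.inr ⟨s, x, hx⟩)))
  exact dist_eq_zero.1 (h.trans (dist_self x))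

/-- Tuples with the same affine type over `A` have Lascar distance at most one over `A`. -/
theorem TypeEqOver.lascarDistLE_one {a b : ∀ i, M (σ i)} (hab : TypeEqOver M A a b) :
    LascarDistLE M A a b 1 := by
  -- Copying all of `M` yields a second affine embedding of `M` in `N`, agreeing with `j` on `A`;
  -- its range is the required model.
  obtain ⟨N, j, e, -, h₂, h₃, h₄⟩ := hab.exists_copy (fun _ => Set.univ)
    fun _ => Set.subset_univ _
  refine ⟨N, j, fun k => if k = 0 then j.tuple a else j.tuple b, if_pos rfl, if_neg one_ne_zero,
    fun k hk => ?_⟩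
  obtain rfl : k = 0 := Nat.lt_one_iff.1 hk
  -- The lift only puts `M` in the universe of `N`, as `SameTypeOverModel` demands.
  refine ⟨Structure.ulift.{u, w, u} M, ⟨fun s x => e ⟨s, x.down, trivial⟩, fun υ φ x => ?_⟩,
    ?_, ?_⟩
  · have h := h₂ (φ.substFree fun i => .free
      (σ := Sum.elim (fun p : Σ s, (Set.univ : Set (M s)) => p.1) fun p : Σ s, A s => p.1)
      (.inl ⟨υ i, (x i).down, trivial⟩))
    refine (φ.value_substFree N _ _).symm.trans (h.trans ((φ.value_substFree M _ _).trans ?_))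
    refine ((φ.eval_ulift x _).trans ?_).symm
    rw [Formula.value]
    congr 1
    exact funext fun k => k.elim0
  · rintro s _ ⟨x, hx, rfl⟩
    exact ⟨⟨x⟩, h₃ s x hx⟩
  · refine h₄ _ ?_
    rintro s _ ⟨x, rfl⟩
    exact ⟨⟨x.down, trivial⟩, rfl⟩

/-- For tuples with the same affine type over `A` and a set `B` containing `A`, some affine
extension has a set with the same affine type over `A` as `B` over which the tuples have the same
affine type. -/
theorem TypeEqOver.exists_setTypeEqOver {a b : ∀ i, M (σ i)} (hab : TypeEqOver M A a b)
    (B : ∀ s, Set (M s)) (hAB : ∀ s, A s ⊆ B s) :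
    ∃ (N : Structure.{u, max u w} L) (j : AffineEmbedding M N) (B' : ∀ s, Set (N s)),
      SetTypeEqOver N (j.image A) B' (j.image B) ∧ (∀ s, j.image A s ⊆ B' s) ∧
        TypeEqOver N B' (j.tuple a) (j.tuple b) := by
  obtain ⟨N, j, e, h₁, h₂, h₃, h₄⟩ := hab.exists_copy B hAB
  refine ⟨N, j, fun s => Set.range fun p : B s => e ⟨s, p⟩, ?_, ?_, h₄ _ fun s x hx => hx⟩
  · refine ⟨Σ s, B s, fun p => p.1, e, j.tuple fun p => p.2.1, fun s x => ?_, fun s x => ?_, ?_⟩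
    · constructor
      · rintro ⟨p, rfl⟩
        exact ⟨⟨s, p⟩, rfl⟩
      · rintro ⟨⟨t, p⟩, h⟩
        cases h
        exact ⟨p, rfl⟩
    · constructor
      · rintro ⟨x, hx, rfl⟩
        exact ⟨⟨s, x, hx⟩, rfl⟩
      · rintro ⟨⟨t, p⟩, h⟩
        cases h
        exact ⟨p.1, p.2, rfl⟩
    · refine .of_forall_value_eq (P := fun s => A s) (fun p => j.toFun p.1 p.2.1) ?_ fun ψ => ?_
      · rintro s _ ⟨x, hx, rfl⟩
        exact ⟨⟨x, hx⟩, rfl⟩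
      -- The type of the copy and the type of `j.image B` over `A` are both computed in `M`. The
      -- enumerations may be infinite, so `h₁` is used rather than `value_eq`, which covers finite
      -- tuples only.
      · rw [h₂, ← h₁]
        congr 1
        funext i
        rcases i with p | p <;> rfl
  · rintro s _ ⟨x, hx, rfl⟩
    exact ⟨⟨x, hAB s hx⟩, h₃ s x hx⟩

end Realization

end AffineLogic

theorem mainTheorem8 (L : AffineLogic.Signature.{u}) (T : AffineLogic.Theory L)
    (hT : T.IsComplete) (M : AffineLogic.Structure.{u, w} L) (hM : M.Models T)
    (A : ∀ s, Set (M s)) {I : Type v} (σ : I → L.Sorts) (a b : ∀ i, M (σ i))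
    (hab : AffineLogic.TypeEqOver M A a b) :
    (∀ B : ∀ s, Set (M s), (∀ s, A s ⊆ B s) →
      ∃ (N : AffineLogic.Structure.{u, max u w} L) (j : AffineLogic.AffineEmbedding M N)
        (B' : ∀ s, Set (N s)),
        AffineLogic.SetTypeEqOver N (j.image A) B' (j.image B) ∧
        (∀ s, j.image A s ⊆ B' s) ∧
        AffineLogic.TypeEqOver N B' (j.tuple a) (j.tuple b)) ∧
    AffineLogic.LascarDistLE M A a b 1 ∧
    AffineLogic.SameLascarType M A a b := by
  exact ⟨fun B hAB => hab.exists_setTypeEqOver B hAB, hab.lascarDistLE_one,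
    1, hab.lascarDistLE_one⟩
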